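/- Let $\Theta=(\theta_m)_{m\ge 1}$ be a sequence of nonnegative real numbers. For $\sigma$ in the symmetric group $S_n$ let $C_m^{(n)}(\sigma)$ be the number of cycles of length $m$ of $\sigma$, and let $$h_n=\frac1{n!}\sum_{\sigma\in S_n}\prod_{m=1}^n\theta_m^{C_m^{(n)}(\sigma)},\qquad \mathbb P_\Theta[\sigma]=\frac{1}{h_n\,n!}\prod_{m=1}^n\theta_m^{C_m^{(n)}(\sigma)} \quad\text{whenever } h_n\neq 0 .$$ Let $g_\Theta(t)=\sum_{k\ge1}\frac{\theta_k}{k}t^k$, and let $r>0$, $\theta>0$, $0<\gamma\le 1$. We say that $g_\Theta\in\mathcal F(r,\theta)$ if $g_\Theta$ is the expansion at $0$ of a function $g$ which, for some $R>r$ and $0<\phi<\pi/2$, is holomorphic in $\Delta_0(r,R,\phi)=\{z\in\mathbb C: |z|<R,\ z\ne r,\ |\arg(z-r)|>\phi\}$ and satisfies, for some constant $K$, $$g(t)=\theta\log\Bigl(\frac1{1-t/r}\Bigr)+K+O(t-r)\qquad (t\to r,\ t\in\Delta_0(r,R,\phi)).$$ We say that $g_\Theta\in e\mathcal F(r,\theta,\gamma)$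 if there is an analytic function $g_0$ on $\{|t|<r\}$ whose Taylor coefficients at $0$ satisfy $[t^n]g_0=O(r^{-n}n^{-1-\gamma})$ and such that $g_\Theta$ is the expansion at $0$ of a function $g$ with $g(t)=\theta\log\bigl(\frac1{1-t/r}\bigr)+g_0(t)$ for $|t|<r$. Here $\log$ is the principal branch. Let $b\in\mathbb N$, and let $Y_1,\dots,Y_b$ be independent Poisson distributed random variables with $\mathbb E[Y_m]=\frac{\theta_m}{m}r^m$. 1. If $g_\Theta\in\mathcal F(r,\theta)$ or $g_\Theta\in e\mathcal F(r,\theta,\gamma)$, then $h_n>0$ for all sufficiently large $n$ (so that $\mathbb P_\Theta$ is a probability measure on $S_n$), and under $\mathbb P_\Theta$, as $n\to\infty$, $$(C_1^{(n)},\dots,C_b^{(n)})\xrightarrow{d}(Y_1,\dots,Y_b).$$ 2. If $g_\Theta\in\mathcal F(r,\theta)$, then for all integers $c_1,\dots,c_b$, as $n\to\infty$, $$\bigl|\mathbb P_\Theta[C_1^{(n)}=c_1,\dots,C_b^{(n)}=c_b]-\mathbb P[Y_1=c_1,\dots,Y_b=c_b]\bigr|=O\Bigl(\frac1n\Bigr).$$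 3. If $g_\Theta\in e\mathcal F(r,\theta,\gamma)$, then for all integers $c_1,\dots,c_b$, as $n\to\infty$, $$\bigl|\mathbb P_\Theta[C_1^{(n)}=c_1,\dots,C_b^{(n)}=c_b]-\mathbb P[Y_1=c_1,\dots,Y_b=c_b]\bigr|=O\Bigl(\frac{\log n}{n^\gamma}\Bigr).$$ -/

import Mathlib

open MeasureTheory ProbabilityTheory Filter Topology Asymptotics

noncomputable section

namespace WeightedPerm

/-- The symmetric group `S_n` with the discrete `σ`-algebra. -/
instance permMeasurableSpace (n : ℕ) : MeasurableSpace (Equiv.Perm (Fin n)) := ⊤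

instance permDiscreteMeasurableSpace (n : ℕ) :
    DiscreteMeasurableSpace (Equiv.Perm (Fin n)) := ⟨fun _ => trivial⟩

/-- `C_m(σ)`: the number of cycles of length `m` of `σ`, that is, the number of parts equal to `m`
in the cycle type of `σ` (fixed points count as cycles of length `1`). -/
def cycleCount {n : ℕ} (m : ℕ) (σ : Equiv.Perm (Fin n)) : ℕ :=
  σ.partition.parts.count m

/-- The weight `∏_{m=1}^n θ_m ^ C_m(σ)`. -/
def weight (Θ : ℕ → ℝ) {n : ℕ} (σ : Equiv.Perm (Fin n)) : ℝ :=
  ∏ m ∈ Finset.Icc 1 n, Θ m ^ cycleCount m σ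

/-- The normalization constant `h_n = (1 / n!) ∑_σ ∏_m θ_m ^ C_m(σ)`. -/
def normConst (Θ : ℕ → ℝ) (n : ℕ) : ℝ :=
  (∑ σ : Equiv.Perm (Fin n), weight Θ σ) / (n.factorial : ℝ)

/-- The generalized weighted measure on `S_n`, giving `σ` the mass
`(1 / (h_n n!)) ∏_m θ_m ^ C_m(σ)`. It is a probability measure exactly when `h_n ≠ 0`
(for nonnegative weights). -/
def permMeasure (Θ : ℕ → ℝ) (n : ℕ) : Measure (Equiv.Perm (Fin n)) :=
  ∑ σ : Equiv.Perm (Fin n),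
    ENNReal.ofReal (weight Θ σ / (normConst Θ n * (n.factorial : ℝ))) • Measure.dirac σ

/-- The random vector `(C_1, …, C_b)` on `S_n`. -/
def cycleVector (b n : ℕ) (σ : Equiv.Perm (Fin n)) : Fin b → ℕ :=
  fun i => cycleCount ((i : ℕ) + 1) σ

/-- The formal power series `g_Θ(t) = ∑_{k ≥ 1} (θ_k / k) t^k`. -/
def gSeries (Θ : ℕ → ℝ) : PowerSeries ℂ :=
  PowerSeries.mk fun k => if k = 0 then 0 else ((Θ k / k : ℝ) : ℂ)

/-- `f` is the power series expansion of the function `g` at `0`. -/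
def IsExpansionAtZero (f : PowerSeries ℂ) (g : ℂ → ℂ) : Prop :=
  ∀ᶠ z in 𝓝 (0 : ℂ), HasSum (fun n => PowerSeries.coeff n f * z ^ n) (g z)

/-- The domain `Δ₀(r, R, φ) = {|z| < R, z ≠ r, |arg (z - r)| > φ}`. -/
def Delta0 (r R φ : ℝ) : Set ℂ :=
  {z : ℂ | ‖z‖ < R ∧ z ≠ (r : ℂ) ∧ φ < |Complex.arg (z - (r : ℂ))|}

/-- The function `g` is of class `F(r, θ)`. -/
def ClassF (r θ : ℝ) (g : ℂ → ℂ) : Prop :=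
  ∃ R φ : ℝ, r < R ∧ 0 < φ ∧ φ < Real.pi / 2 ∧
    DifferentiableOn ℂ g (Delta0 r R φ) ∧
    ∃ K : ℂ,
      (fun t : ℂ => g t - ((θ : ℂ) * Complex.log (1 / (1 - t / (r : ℂ))) + K))
        =O[𝓝[Delta0 r R φ] (r : ℂ)] fun t : ℂ => t - (r : ℂ)

/-- The function `g` is of class `eF(r, θ, γ)`. -/
def ClassEF (r θ γ : ℝ) (g : ℂ → ℂ) : Prop :=
  ∃ g₀ : ℂ → ℂ, DifferentiableOn ℂ g₀ (Metric.ball 0 r) ∧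
    (∀ t ∈ Metric.ball (0 : ℂ) r,
      g t = (θ : ℂ) * Complex.log (1 / (1 - t / (r : ℂ))) + g₀ t) ∧
    ∃ a : PowerSeries ℂ, IsExpansionAtZero a g₀ ∧
      (fun n : ℕ => PowerSeries.coeff n a)
        =O[atTop] fun n : ℕ => (r ^ n)⁻¹ * (n : ℝ) ^ (-1 - γ)

/-- A power series is of class `F(r, θ)` if it is the expansion at `0` of a function of
that class. -/
def SeriesClassF (r θ : ℝ) (f : PowerSeries ℂ) : Prop :=
  ∃ g : ℂ → ℂ, IsExpansionAtZero f g ∧ ClassF r θ g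

/-- A power series is of class `eF(r, θ, γ)` if it is the expansion at `0` of a function of
that class. -/
def SeriesClassEF (r θ γ : ℝ) (f : PowerSeries ℂ) : Prop :=
  ∃ g : ℂ → ℂ, IsExpansionAtZero f g ∧ ClassEF r θ γ g

end WeightedPerm

end

noncomputable section

namespace WeightedPerm

/-! The weight of a permutation depends only on its cycle type, so Cauchy's count of conjugacy
classes turns h_n into a sum over partitions of n of ∏ (θ_m/m)^(k_m)/k_m!. Hence h_n = [t^n]
exp(g_Θ(t)) (`coeff_taylor_exp_gSeries`). Prescribing C_1, …, C_b removes the small parts, of total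
size s = ∑ i c_i, and leaves a partition into parts larger than b. So the probability is ∏
(θ_m/m)^(c_m)/c_m! times [t^(n-s)] exp(g_Θ - p_b) / [t^n] exp(g_Θ), where p_b is the sum of the
terms of g_Θ up to degree b (`permMeasure_real_cycleVector`). The Poisson probability is the same
product times r^s exp(-p_b(r)), and it remains to compare the ratio of coefficients with this
number.

In both classes exp(g_Θ) looks like e^L (1 - t/r)^(-θ) near r, and subtracting p_b only replaces L
by L - p_b(r). The coefficients a_n of (1 - t)^(-θ) have order n^(θ-1), and a_(n-s) - a_n =
O(n^(θ-2)). So the ratio has the right limit, with an error governed by 1/n and by the relative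
error of the coefficient asymptotics (`partitionSum_ratio_isBigO`).

That relative error is where the classes differ. For `F`, the remainder exp(g) - e^K (1 - t)^(-θ) is
O(|t - 1|^(1-θ)) on a domain reaching beyond the unit disc. Cauchy estimates for its third
derivative and a mean value over circles give coefficients O(n^(θ-2))
(`coeff_taylor_isBigO_of_slitDomain`). For `eF`, the coefficients of exp(g₀) are again O(n^(-1-γ))
after scaling to r = 1 (`hasDecay_taylor_exp`), and convolving them with a_n costs a relative error
log n / n^γ (`exists_norm_convolution_sub_le`). -/

/-! ### Taylor series and the recursion for an exponential -/

/-- The Taylor series at `0` of a complex function. -/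
def taylor (F : ℂ → ℂ) : PowerSeries ℂ :=
  PowerSeries.mk fun n => iteratedDeriv n F 0 / (n.factorial : ℂ)

lemma isExpansionAtZero_iff {f : PowerSeries ℂ} {g : ℂ → ℂ} :
    IsExpansionAtZero f g ↔
      HasFPowerSeriesAt g
        (FormalMultilinearSeries.ofScalars ℂ fun n => PowerSeries.coeff n f) 0 := by
  rw [hasFPowerSeriesAt_iff, IsExpansionAtZero]
  simp [FormalMultilinearSeries.coeff_ofScalars, mul_comm]

lemma isExpansionAtZero_taylor {F : ℂ → ℂ} (hF : AnalyticAt ℂ F 0) :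
    IsExpansionAtZero (taylor F) F := by
  rw [isExpansionAtZero_iff]
  simpa [taylor] using hF.hasFPowerSeriesAt

lemma IsExpansionAtZero.analyticAt {f : PowerSeries ℂ} {g : ℂ → ℂ}
    (h : IsExpansionAtZero f g) : AnalyticAt ℂ g 0 :=
  ⟨_, isExpansionAtZero_iff.1 h⟩

lemma IsExpansionAtZero.unique {f f' : PowerSeries ℂ} {g : ℂ → ℂ}
    (h : IsExpansionAtZero f g) (h' : IsExpansionAtZero f' g) : f = f' := by
  have := (isExpansionAtZero_iff.1 h).eq_formalMultilinearSeries (isExpansionAtZero_iff.1 h')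
  ext n
  have := congrArg (fun p => FormalMultilinearSeries.coeff p n) this
  simpa [FormalMultilinearSeries.coeff_ofScalars] using this

lemma IsExpansionAtZero.eq_taylor {f : PowerSeries ℂ} {g : ℂ → ℂ}
    (h : IsExpansionAtZero f g) : f = taylor g :=
  h.unique (isExpansionAtZero_taylor h.analyticAt)

lemma IsExpansionAtZero.congr {f : PowerSeries ℂ} {g g' : ℂ → ℂ}
    (h : IsExpansionAtZero f g) (hg : g =ᶠ[𝓝 0] g') : IsExpansionAtZero f g' := by
  filter_upwards [h, hg] with z hz hz'
  rwa [← hz']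

lemma IsExpansionAtZero.comp_mul {f : PowerSeries ℂ} {g : ℂ → ℂ}
    (h : IsExpansionAtZero f g) (r : ℂ) :
    IsExpansionAtZero (PowerSeries.rescale r f) fun z => g (r * z) := by
  have : Tendsto (fun z : ℂ => r * z) (𝓝 0) (𝓝 0) := by
    have : ContinuousAt (fun z : ℂ => r * z) 0 := by fun_prop
    simpa [ContinuousAt] using this
  filter_upwards [this.eventually h] with z hz
  simpa [PowerSeries.coeff_rescale, mul_pow, mul_comm, mul_left_comm, mul_assoc] using hz

lemma IsExpansionAtZero.sub {f f' : PowerSeries ℂ} {g g' : ℂ → ℂ}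
    (h : IsExpansionAtZero f g) (h' : IsExpansionAtZero f' g') :
    IsExpansionAtZero (f - f') fun z => g z - g' z := by
  filter_upwards [h, h'] with z hz hz'
  simpa [sub_mul] using hz.sub hz'

/-- Leibniz's rule: division by n! turns its binomial coefficients into the Cauchy product. -/
lemma taylor_mul {F G : ℂ → ℂ} (hF : AnalyticAt ℂ F 0) (hG : AnalyticAt ℂ G 0) :
    taylor (fun z => F z * G z) = taylor F * taylor G := by
  ext n
  rw [taylor, PowerSeries.coeff_mk, iteratedDeriv_fun_mul hF.contDiffAt hG.contDiffAt,
    PowerSeries.coeff_mul, Finset.Nat.sum_antidiagonal_eq_sum_range_succ_mk, Finset.sum_div]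
  refine Finset.sum_congr rfl fun k hk => ?_
  have hk : k ≤ n := by simpa [Nat.lt_succ_iff] using hk
  simp only [taylor, PowerSeries.coeff_mk]
  rw [Nat.cast_choose ℂ hk]
  have h (m : ℕ) : (m.factorial : ℂ) ≠ 0 := by exact_mod_cast m.factorial_ne_zero
  have := h n
  field_simp

lemma coeff_taylor_deriv (F : ℂ → ℂ) (n : ℕ) :
    PowerSeries.coeff n (taylor (deriv F)) = (n + 1) * PowerSeries.coeff (n + 1) (taylor F) := by
  simp only [taylor, PowerSeries.coeff_mk, iteratedDeriv_succ', Nat.factorial_succ]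
  push_cast
  have : (n + 1 : ℂ) ≠ 0 := by exact_mod_cast n.succ_ne_zero
  field_simp

/-- The coefficients of `exp ∘ g` satisfy the recursion coming from `(exp ∘ g)' = g' · exp ∘ g`. -/
lemma coeff_taylor_exp_succ {g : ℂ → ℂ} (hg : AnalyticAt ℂ g 0) (n : ℕ) :
    (n + 1) * PowerSeries.coeff (n + 1) (taylor fun z => Complex.exp (g z)) =
      ∑ k ∈ Finset.range (n + 1), (k + 1) * PowerSeries.coeff (k + 1) (taylor g) *
        PowerSeries.coeff (n - k) (taylor fun z => Complex.exp (g z)) := by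
  have hE : AnalyticAt ℂ (fun z => Complex.exp (g z)) 0 := hg.cexp
  have hd : deriv (fun z => Complex.exp (g z)) =ᶠ[𝓝 0] fun z => deriv g z * Complex.exp (g z) := by
    filter_upwards [hg.eventually_analyticAt] with z hz
    rw [deriv_cexp hz.differentiableAt, mul_comm]
  have h1 : taylor (deriv fun z => Complex.exp (g z)) =
      taylor (fun z => deriv g z * Complex.exp (g z)) :=
    ((isExpansionAtZero_taylor hE.deriv).congr hd).eq_taylor
  rw [← coeff_taylor_deriv, h1, taylor_mul hg.deriv hE, PowerSeries.coeff_mul,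
    Finset.Nat.sum_antidiagonal_eq_sum_range_succ_mk]
  simp only [coeff_taylor_deriv]

lemma coeff_zero_taylor (g : ℂ → ℂ) : PowerSeries.coeff 0 (taylor g) = g 0 := by
  simp [taylor]

/-- A sequence satisfying the recursion of `exp ∘ g` is the coefficient sequence of `exp ∘ g`. -/
lemma coeff_taylor_exp_eq {g : ℂ → ℂ} (hg : AnalyticAt ℂ g 0) (H : ℕ → ℂ)
    (h0 : H 0 = Complex.exp (g 0))
    (hH : ∀ n : ℕ, (n + 1) * H (n + 1) = ∑ k ∈ Finset.range (n + 1),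
      (k + 1) * PowerSeries.coeff (k + 1) (taylor g) * H (n - k)) (n : ℕ) :
    PowerSeries.coeff n (taylor fun z => Complex.exp (g z)) = H n := by
  induction n using Nat.strong_induction_on with
  | _ n ih =>
    rcases n with _ | n
    · rw [coeff_zero_taylor, h0]
    · have hn : (n + 1 : ℂ) ≠ 0 := by exact_mod_cast n.succ_ne_zero
      refine mul_left_cancel₀ hn ?_
      rw [hH, coeff_taylor_exp_succ hg]
      refine Finset.sum_congr rfl fun k _ => ?_
      rw [ih (n - k) (by omega)]

/-! ### Partition sums and cycle types -/

/-- The weight `∏_m (θ_m / m) ^ k_m / k_m!` of a multiset in which `m` occurs `k_m` times. -/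
def multisetWeight (θ : ℕ → ℝ) (M : Multiset ℕ) : ℝ :=
  ∏ m ∈ M.toFinset, (θ m / m) ^ M.count m / (M.count m).factorial

/-- The sum of the weights of all partitions of `n`. -/
def partitionSum (θ : ℕ → ℝ) (n : ℕ) : ℝ :=
  ∑ p : n.Partition, multisetWeight θ p.parts

lemma multisetWeight_eq_prod (θ : ℕ → ℝ) {M : Multiset ℕ} {s : Finset ℕ} (h : M.toFinset ⊆ s) :
    multisetWeight θ M = ∏ m ∈ s, (θ m / m) ^ M.count m / (M.count m).factorial := by
  refine Finset.prod_subset h fun m _ hm => ?_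
  rw [Multiset.mem_toFinset] at hm
  simp [Multiset.count_eq_zero_of_notMem hm]

lemma multisetWeight_add_of_disjoint (θ : ℕ → ℝ) {M N : Multiset ℕ} (h : Disjoint M N) :
    multisetWeight θ (M + N) = multisetWeight θ M * multisetWeight θ N := by
  have hd : Disjoint M.toFinset N.toFinset := Multiset.disjoint_toFinset.2 h
  rw [multisetWeight, Multiset.toFinset_add, Finset.prod_union hd]
  congr 1
  · refine Finset.prod_congr rfl fun m hm => ?_
    have : m ∉ N := fun hN => Finset.disjoint_left.1 hd hm (Multiset.mem_toFinset.2 hN)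
    simp [Multiset.count_add, Multiset.count_eq_zero_of_notMem this]
  · refine Finset.prod_congr rfl fun m hm => ?_
    have : m ∉ M := fun hN => Finset.disjoint_left.1 hd (Multiset.mem_toFinset.2 hN) hm
    simp [Multiset.count_add, Multiset.count_eq_zero_of_notMem this]

lemma multisetWeight_congr {θ θ' : ℕ → ℝ} {M : Multiset ℕ} (h : ∀ m ∈ M, θ m = θ' m) :
    multisetWeight θ M = multisetWeight θ' M :=
  Finset.prod_congr rfl fun m hm => by rw [h m (Multiset.mem_toFinset.1 hm)]

lemma multisetWeight_eq_zero {θ : ℕ → ℝ} {M : Multiset ℕ} {m : ℕ} (hm : m ∈ M) (h : θ m = 0) :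
    multisetWeight θ M = 0 := by
  refine Finset.prod_eq_zero (Multiset.mem_toFinset.2 hm) ?_
  have := Multiset.count_ne_zero.2 hm
  simp [h, this]

/-- With k copies of m after insertion, m k cancels one denominator m and the top factor of k!,
which leaves a single θ_m. -/
lemma mul_count_mul_multisetWeight_cons (θ : ℕ → ℝ) {m : ℕ} (hm : m ≠ 0) (M : Multiset ℕ) :
    (m : ℝ) * (m ::ₘ M).count m * multisetWeight θ (m ::ₘ M) = θ m * multisetWeight θ M := by
  have hm' : (m : ℝ) ≠ 0 := by exact_mod_cast hm
  have hs : m ∈ (m ::ₘ M).toFinset := by simp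
  rw [multisetWeight_eq_prod θ (M := M) (s := (m ::ₘ M).toFinset) (by simp), multisetWeight,
    ← Finset.mul_prod_erase _ _ hs, ← Finset.mul_prod_erase _ _ hs]
  have : ∏ x ∈ (m ::ₘ M).toFinset.erase m,
      (θ x / x) ^ (m ::ₘ M).count x / ((m ::ₘ M).count x).factorial =
      ∏ x ∈ (m ::ₘ M).toFinset.erase m, (θ x / x) ^ M.count x / (M.count x).factorial := by
    refine Finset.prod_congr rfl fun x hx => ?_
    rw [Multiset.count_cons_of_ne (Finset.ne_of_mem_erase hx)]
  rw [this, Multiset.count_cons_self, pow_succ, Nat.factorial_succ]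
  push_cast
  have h1 : ((M.count m : ℝ) + 1) ≠ 0 := by positivity
  have h2 : ((M.count m).factorial : ℝ) ≠ 0 := by positivity
  field_simp

/-- Removing one part `m` is a bijection from the partitions of `n` having `m` as a part to
the partitions of `n - m`. -/
lemma sum_partition_mem (F : Multiset ℕ → ℝ) {n m : ℕ} (hm : 0 < m) (hmn : m ≤ n) :
    ∑ p : n.Partition with m ∈ p.parts, F p.parts =
      ∑ q : (n - m).Partition, F (m ::ₘ q.parts) := by
  symm
  refine Finset.sum_bij'
    (fun q _ => ⟨m ::ₘ q.parts, fun {i} hi => ?_, ?_⟩)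
    (fun p hp => ⟨p.parts.erase m, fun {i} hi => p.parts_pos (Multiset.mem_of_mem_erase hi), ?_⟩)
    ?_ ?_ ?_ ?_ ?_
  · rcases Multiset.mem_cons.1 hi with rfl | hi
    exacts [hm, q.parts_pos hi]
  · rw [Multiset.sum_cons, q.parts_sum]; omega
  · have := Multiset.sum_erase (Finset.mem_filter.1 hp).2
    rw [p.parts_sum] at this; omega
  · simp
  · simp
  · intro q _; ext1; simp
  · intro p hp; ext1; simpa using Multiset.cons_erase (Finset.mem_filter.1 hp).2
  · simp

lemma sum_mul_count_eq {n : ℕ} (p : n.Partition) :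
    ∑ m ∈ Finset.Icc 1 n, (m : ℝ) * p.parts.count m = n := by
  have h : p.parts.toFinset ⊆ Finset.Icc 1 n := fun m hm => by
    rw [Multiset.mem_toFinset] at hm
    exact Finset.mem_Icc.2 ⟨p.parts_pos hm, p.parts_sum ▸ Multiset.le_sum_of_mem hm⟩
  have := Finset.sum_multiset_count_of_subset p.parts _ h
  rw [p.parts_sum] at this
  conv_rhs => rw [this]
  push_cast
  exact Finset.sum_congr rfl fun m _ => by simp [mul_comm]

lemma partitionSum_zero (θ : ℕ → ℝ) : partitionSum θ 0 = 1 := by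
  simp [partitionSum, multisetWeight]

/-- Double counting: write n as ∑ m k_m in each partition, exchange the sums, and remove one part m.
This is the recursion of the coefficients of an exponential. -/
lemma mul_partitionSum (θ : ℕ → ℝ) (n : ℕ) :
    (n : ℝ) * partitionSum θ n = ∑ m ∈ Finset.Icc 1 n, θ m * partitionSum θ (n - m) := by
  have h1 : (n : ℝ) * partitionSum θ n = ∑ m ∈ Finset.Icc 1 n, ∑ p : n.Partition,
      (m : ℝ) * p.parts.count m * multisetWeight θ p.parts := by
    rw [Finset.sum_comm, partitionSum, Finset.mul_sum]
    refine Finset.sum_congr rfl fun p _ => ?_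
    rw [← Finset.sum_mul, sum_mul_count_eq]
  rw [h1]
  refine Finset.sum_congr rfl fun m hm => ?_
  obtain ⟨hm1, hmn⟩ := Finset.mem_Icc.1 hm
  have h2 : ∑ p : n.Partition, (m : ℝ) * p.parts.count m * multisetWeight θ p.parts =
      ∑ p : n.Partition with m ∈ p.parts,
        (fun M => (m : ℝ) * M.count m * multisetWeight θ M) p.parts := by
    rw [Finset.sum_filter]
    refine Finset.sum_congr rfl fun p _ => ?_
    split_ifs with h
    · rfl
    · simp [Multiset.count_eq_zero_of_notMem h]
  rw [h2, sum_partition_mem (fun M => (m : ℝ) * M.count m * multisetWeight θ M) hm1 hmn,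
    partitionSum, Finset.mul_sum]
  exact Finset.sum_congr rfl fun q _ => mul_count_mul_multisetWeight_cons θ (by omega) _

/-- Needed because `σ.partition` is a partition of `Fintype.card (Fin n)` rather than of `n`. -/
lemma sum_partition_congr (F : Multiset ℕ → ℝ) {m n : ℕ} (h : m = n) :
    ∑ p : m.Partition, F p.parts = ∑ p : n.Partition, F p.parts := by
  subst h; rfl

open Equiv.Perm in
-- Cauchy's formula for the size of a conjugacy class. The count by `cycleType` ignores fixed
-- points, so the parts equal to 1 are split off and their factorial is treated separately.
lemma card_partition_mul {α : Type*} [Fintype α] [DecidableEq α]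
    (p : (Fintype.card α).Partition) :
    ((Finset.univ.filter fun σ : Equiv.Perm α => σ.partition = p).card : ℝ) *
      ∏ m ∈ p.parts.toFinset, (m : ℝ) ^ p.parts.count m * (p.parts.count m).factorial =
      (Fintype.card α).factorial := by
  set M := p.parts.filter fun n => 2 ≤ n with hM
  have hone : p.parts.filter (fun n => ¬ 2 ≤ n) = Multiset.replicate (p.parts.count 1) 1 := by
    rw [← Multiset.filter_eq' p.parts 1]
    refine Multiset.filter_congr fun m hm => ?_
    have := p.parts_pos hm
    omega
  have hdec : M + Multiset.replicate (p.parts.count 1) 1 = p.parts := by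
    rw [← hone]; exact Multiset.filter_add_not _ _
  have hsum : M.sum + p.parts.count 1 = Fintype.card α := by
    have := congrArg Multiset.sum hdec
    rwa [Multiset.sum_add, Multiset.sum_replicate, p.parts_sum, smul_eq_mul, mul_one] at this
  have hfib : (Finset.univ.filter fun σ : Equiv.Perm α => σ.partition = p) =
      Finset.univ.filter fun σ : Equiv.Perm α => σ.cycleType = M := by
    refine Finset.filter_congr fun σ _ => ⟨fun h => ?_, fun h => ?_⟩
    · rw [← filter_parts_partition_eq_cycleType, h]
    · rw [Nat.Partition.ext_iff, parts_partition, ← sum_cycleType, h, ← hdec]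
      congr 2
      omega
  have hM2 : ∀ a ∈ M, 2 ≤ a := fun a ha => (Multiset.mem_filter.1 ha).2
  have key := card_of_cycleType_mul_eq α M
  rw [if_pos ⟨by omega, hM2⟩, ← hfib, show Fintype.card α - M.sum = p.parts.count 1 by omega] at key
  rw [← key, Nat.cast_mul, Nat.cast_mul, Nat.cast_mul, Nat.cast_prod]
  congr 1
  have hprod : (M.prod : ℝ) = ∏ m ∈ M.toFinset, (m : ℝ) ^ M.count m := by
    rw [Finset.prod_multiset_count M]; push_cast; rfl
  have h1M : 1 ∉ M := fun h => by simpa using hM2 1 h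
  have hsub : p.parts.toFinset ⊆ insert 1 M.toFinset := fun m hm => by
    rw [Multiset.mem_toFinset] at hm
    have := p.parts_pos hm
    rw [Finset.mem_insert, Multiset.mem_toFinset, hM, Multiset.mem_filter]
    by_cases h : 2 ≤ m
    · exact Or.inr ⟨hm, h⟩
    · exact Or.inl (by omega)
  rw [Finset.prod_subset hsub, Finset.prod_insert (by simpa using h1M), hprod,
    mul_assoc ((p.parts.count 1).factorial : ℝ),
    ← Finset.prod_mul_distrib]
  · simp only [Nat.cast_one, one_pow, one_mul]
    congr 1
    refine Finset.prod_congr rfl fun m hm => ?_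
    rw [Multiset.mem_toFinset] at hm
    rw [hM, Multiset.count_filter_of_pos (hM2 m hm)]
  · intro m _ hm
    rw [Multiset.mem_toFinset] at hm
    simp [Multiset.count_eq_zero_of_notMem hm]

/-- Sums over permutations weighted by cycle type, as sums over partitions. -/
lemma sum_weight_mul_div_factorial (Θ : ℕ → ℝ) (n : ℕ) (F : Multiset ℕ → ℝ) :
    (∑ σ : Equiv.Perm (Fin n), weight Θ σ * F σ.partition.parts) / n.factorial =
      ∑ p : n.Partition, multisetWeight Θ p.parts * F p.parts := by
  rw [← sum_partition_congr (fun M => multisetWeight Θ M * F M) (Fintype.card_fin n)]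
  rw [← Finset.sum_fiberwise (s := Finset.univ) (g := fun σ : Equiv.Perm (Fin n) => σ.partition),
    Finset.sum_div]
  refine Finset.sum_congr rfl fun p _ => ?_
  have hsub : p.parts.toFinset ⊆ Finset.Icc 1 n := fun m hm => by
    rw [Multiset.mem_toFinset] at hm
    refine Finset.mem_Icc.2 ⟨p.parts_pos hm, ?_⟩
    have h1 := Multiset.le_sum_of_mem hm
    have h2 := p.parts_sum
    simp only [Fintype.card_fin] at h2
    omega
  have hw (σ : Equiv.Perm (Fin n)) (hσ : σ ∈ Finset.univ.filter fun σ => σ.partition = p) :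
      weight Θ σ * F σ.partition.parts =
        (∏ m ∈ p.parts.toFinset, Θ m ^ p.parts.count m) * F p.parts := by
    rw [(Finset.mem_filter.1 hσ).2]
    congr 1
    simp only [weight, cycleCount, (Finset.mem_filter.1 hσ).2]
    refine (Finset.prod_subset hsub fun m _ hm => ?_).symm
    rw [Multiset.mem_toFinset] at hm
    simp [Multiset.count_eq_zero_of_notMem hm]
  rw [Finset.sum_congr rfl hw, Finset.sum_const, nsmul_eq_mul]
  have hc := card_partition_mul p
  simp only [Fintype.card_fin] at hc
  have hne : ∀ m ∈ p.parts.toFinset, (m : ℝ) ≠ 0 := fun m hm => by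
    have := p.parts_pos (Multiset.mem_toFinset.1 hm)
    positivity
  have hpos : ∏ m ∈ p.parts.toFinset,
      (m : ℝ) ^ p.parts.count m * (p.parts.count m).factorial ≠ 0 :=
    Finset.prod_ne_zero_iff.2 fun m hm => mul_ne_zero (pow_ne_zero _ (hne m hm)) (by positivity)
  have hW : multisetWeight Θ p.parts = (∏ m ∈ p.parts.toFinset, Θ m ^ p.parts.count m) /
      ∏ m ∈ p.parts.toFinset, (m : ℝ) ^ p.parts.count m * (p.parts.count m).factorial := by
    rw [multisetWeight, ← Finset.prod_div_distrib]
    refine Finset.prod_congr rfl fun m _ => ?_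
    rw [div_pow, div_div]
  rw [hW, ← hc]
  have hcard : ((Finset.univ.filter fun σ : Equiv.Perm (Fin n) => σ.partition = p).card : ℝ) ≠ 0 := by
    intro h
    rw [h, zero_mul] at hc
    exact (Nat.cast_ne_zero.2 (Nat.factorial_ne_zero _)) hc.symm
  field_simp

lemma normConst_eq_partitionSum (Θ : ℕ → ℝ) (n : ℕ) : normConst Θ n = partitionSum Θ n := by
  simpa [normConst, partitionSum] using sum_weight_mul_div_factorial Θ n fun _ => 1

/-- The multiset with `c i` elements equal to `i + 1`. -/
def multisetOfCounts {b : ℕ} (c : Fin b → ℕ) : Multiset ℕ :=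
  ∑ i : Fin b, Multiset.replicate (c i) ((i : ℕ) + 1)

/-- The sequence `θ` with its first entries, up to index `b`, replaced by zero. -/
def truncate (b : ℕ) (θ : ℕ → ℝ) (m : ℕ) : ℝ := if m ≤ b then 0 else θ m

lemma sum_multisetOfCounts {b : ℕ} (c : Fin b → ℕ) :
    (multisetOfCounts c).sum = ∑ i : Fin b, c i * ((i : ℕ) + 1) := by
  simp [multisetOfCounts, Multiset.sum_sum]

lemma count_multisetOfCounts {b : ℕ} (c : Fin b → ℕ) (i : Fin b) :
    (multisetOfCounts c).count ((i : ℕ) + 1) = c i := by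
  rw [multisetOfCounts, Multiset.count_sum', Finset.sum_eq_single i]
  · simp
  · intro j _ hj
    rw [Multiset.count_replicate, if_neg]
    intro h
    exact hj (Fin.ext (by omega))
  · simp

lemma mem_multisetOfCounts {b : ℕ} {c : Fin b → ℕ} {m : ℕ} (hm : m ∈ multisetOfCounts c) :
    0 < m ∧ m ≤ b := by
  rw [multisetOfCounts, Multiset.mem_sum] at hm
  obtain ⟨i, _, hi⟩ := hm
  have := Multiset.eq_of_mem_replicate hi
  have := i.2
  omega

lemma multisetWeight_multisetOfCounts (θ : ℕ → ℝ) {b : ℕ} (c : Fin b → ℕ) :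
    multisetWeight θ (multisetOfCounts c) =
      ∏ i : Fin b, (θ ((i : ℕ) + 1) / ((i : ℕ) + 1 : ℕ)) ^ c i / (c i).factorial := by
  rw [multisetWeight_eq_prod θ
    (s := Finset.univ.image fun i : Fin b => (i : ℕ) + 1), Finset.prod_image]
  · simp only [count_multisetOfCounts]
  · intro i _ j _ h
    exact Fin.ext (by simpa using h)
  · intro m hm
    obtain ⟨h0, h1⟩ := mem_multisetOfCounts (Multiset.mem_toFinset.1 hm)
    exact Finset.mem_image.2 ⟨⟨m - 1, by omega⟩, Finset.mem_univ _, by simp; omega⟩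

lemma eq_multisetOfCounts {b : ℕ} {c : Fin b → ℕ} {M : Multiset ℕ} (hpos : ∀ m ∈ M, 0 < m)
    (h : ∀ i : Fin b, M.count ((i : ℕ) + 1) = c i) :
    M.filter (fun m => m ≤ b) = multisetOfCounts c := by
  ext m
  by_cases hm : 0 < m ∧ m ≤ b
  · obtain ⟨i, rfl⟩ : ∃ i : Fin b, (i : ℕ) + 1 = m := ⟨⟨m - 1, by omega⟩, by simp; omega⟩
    have hf : (M.filter fun m => m ≤ b).count ((i : ℕ) + 1) = M.count ((i : ℕ) + 1) :=
      Multiset.count_filter_of_pos (p := fun m => m ≤ b) hm.2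
    rw [hf, h, count_multisetOfCounts]
  · rw [Multiset.count_eq_zero_of_notMem fun h' => hm (mem_multisetOfCounts h'),
      Multiset.count_eq_zero_of_notMem fun h' => hm ?_]
    rw [Multiset.mem_filter] at h'
    exact ⟨hpos m h'.1, h'.2⟩

/-- A partition with these counts is `multisetOfCounts c` plus a partition into parts larger than b.
The weight is multiplicative over this disjoint sum, and truncation kills exactly the partitions
that still have a part at most b. -/
lemma sum_partition_counts (θ : ℕ → ℝ) {b : ℕ} (c : Fin b → ℕ) {n : ℕ}
    (hn : (multisetOfCounts c).sum ≤ n) :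
    ∑ p : n.Partition, multisetWeight θ p.parts *
        (if ∀ i : Fin b, p.parts.count ((i : ℕ) + 1) = c i then 1 else 0) =
      multisetWeight θ (multisetOfCounts c) *
        partitionSum (truncate b θ) (n - (multisetOfCounts c).sum) := by
  set N := multisetOfCounts c with hN
  have hR : partitionSum (truncate b θ) (n - N.sum) =
      ∑ q : (n - N.sum).Partition with ∀ m ∈ q.parts, b < m, multisetWeight θ q.parts := by
    rw [partitionSum, Finset.sum_filter]
    refine Finset.sum_congr rfl fun q _ => ?_
    split_ifs with h
    · exact multisetWeight_congr fun m hm => if_neg (by have := h m hm; omega)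
    · push Not at h
      obtain ⟨m, hm, hmb⟩ := h
      exact multisetWeight_eq_zero hm (if_pos hmb)
  have hcount (q : Multiset ℕ) (hq : ∀ m ∈ q, b < m) (i : Fin b) :
      (N + q).count ((i : ℕ) + 1) = c i := by
    rw [Multiset.count_add, count_multisetOfCounts, Multiset.count_eq_zero_of_notMem, add_zero]
    intro h
    have := hq _ h
    have := i.2
    omega
  have hdec (p : n.Partition) (hp : ∀ i : Fin b, p.parts.count ((i : ℕ) + 1) = c i) :
      N + p.parts.filter (fun m => b < m) = p.parts := by
    rw [hN, ← eq_multisetOfCounts (fun m hm => p.parts_pos hm) hp]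
    simpa only [not_le] using Multiset.filter_add_not (fun m => m ≤ b) p.parts
  simp only [mul_ite, mul_one, mul_zero]
  rw [hR, Finset.mul_sum, ← Finset.sum_filter]
  symm
  refine Finset.sum_bij'
    (fun q _ => ⟨N + q.parts, fun {i} hi => ?_, ?_⟩)
    (fun p hp => ⟨p.parts.filter fun m => b < m,
      fun {i} hi => p.parts_pos (Multiset.mem_of_mem_filter hi), ?_⟩)
    ?_ ?_ ?_ ?_ ?_
  · rcases Multiset.mem_add.1 hi with hi | hi
    exacts [(mem_multisetOfCounts hi).1, q.parts_pos hi]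
  · rw [Multiset.sum_add, q.parts_sum]; omega
  · have := congrArg Multiset.sum (hdec p (Finset.mem_filter.1 hp).2)
    rw [Multiset.sum_add, p.parts_sum] at this; omega
  · intro q hq
    exact Finset.mem_filter.2 ⟨Finset.mem_univ _, hcount _ (Finset.mem_filter.1 hq).2⟩
  · intro p _
    exact Finset.mem_filter.2 ⟨Finset.mem_univ _, fun m hm => (Multiset.mem_filter.1 hm).2⟩
  · intro q hq
    ext1
    change (N + q.parts).filter (fun m => b < m) = q.parts
    rw [Multiset.filter_add, Multiset.filter_eq_nil.2, Multiset.filter_eq_self.2, zero_add]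
    · exact (Finset.mem_filter.1 hq).2
    · intro m hm
      have := (mem_multisetOfCounts hm).2
      omega
  · intro p hp
    ext1
    exact hdec p (Finset.mem_filter.1 hp).2
  · intro q hq
    rw [multisetWeight_add_of_disjoint]
    refine Multiset.disjoint_left.2 fun {m} hm hm' => ?_
    have := (mem_multisetOfCounts hm).2
    have := (Finset.mem_filter.1 hq).2 m hm'
    omega

/-! ### The coefficients of (1 - t)^(-θ) -/

/-- The coefficients of `(1 - t) ^ (-θ)`. -/
def negBinomCoeff (θ : ℝ) (n : ℕ) : ℝ := ∏ k ∈ Finset.range n, (θ + k) / (k + 1)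

lemma negBinomCoeff_succ (θ : ℝ) (n : ℕ) :
    negBinomCoeff θ (n + 1) = negBinomCoeff θ n * ((θ + n) / (n + 1)) :=
  Finset.prod_range_succ _ _

lemma negBinomCoeff_pos {θ : ℝ} (hθ : 0 < θ) (n : ℕ) : 0 < negBinomCoeff θ n :=
  Finset.prod_pos fun k _ => by positivity

/-- The coefficient form of F' = θ (1 - t)⁻¹ F for F = (1 - t)^(-θ), which is the recursion required
by `coeff_taylor_exp_eq`. -/
lemma mul_sum_negBinomCoeff (θ : ℝ) (n : ℕ) :
    θ * ∑ k ∈ Finset.range (n + 1), negBinomCoeff θ k = (n + 1) * negBinomCoeff θ (n + 1) := by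
  induction n with
  | zero => simp [negBinomCoeff]
  | succ n ih =>
    rw [Finset.sum_range_succ, mul_add, ih, negBinomCoeff_succ θ (n + 1)]
    push_cast
    have : (n + 1 + 1 : ℝ) ≠ 0 := by positivity
    field_simp
    ring

lemma isExpansionAtZero_log (θ : ℝ) :
    IsExpansionAtZero (PowerSeries.mk fun n => (θ : ℂ) * (1 / n))
      fun z => θ * Complex.log (1 / (1 - z)) := by
  filter_upwards [Metric.ball_mem_nhds (0 : ℂ) one_pos] with z hz
  have hz : ‖z‖ < 1 := by simpa using hz
  have h := (Complex.hasSum_taylorSeries_neg_log hz).mul_left (θ : ℂ)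
  -- The rule log(1/w) = -log w fails on the negative axis; here Re(1 - z) > 0.
  have harg : (1 - z).arg ≠ Real.pi := by
    have h1 : 0 < (1 - z).re := by
      have := (Complex.abs_re_le_norm z).trans_lt hz
      rw [abs_lt] at this
      simp; linarith [this.2]
    intro h2
    rw [Complex.arg_eq_pi_iff] at h2
    linarith [h2.1]
  rw [one_div, Complex.log_inv _ harg]
  simpa [div_eq_inv_mul, mul_assoc] using h

lemma coeff_taylor_exp_log (θ : ℝ) (n : ℕ) :
    PowerSeries.coeff n (taylor fun z => Complex.exp (θ * Complex.log (1 / (1 - z)))) =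
      negBinomCoeff θ n := by
  have hL := isExpansionAtZero_log θ
  refine coeff_taylor_exp_eq hL.analyticAt (fun n => (negBinomCoeff θ n : ℂ)) ?_ (fun n => ?_) n
  · simp [negBinomCoeff]
  · rw [← hL.eq_taylor]
    have h1 : ∀ k : ℕ, ((k : ℂ) + 1) * PowerSeries.coeff (k + 1)
        (PowerSeries.mk fun n : ℕ => (θ : ℂ) * (1 / n)) = θ := fun k => by
      have : (k + 1 : ℂ) ≠ 0 := by exact_mod_cast k.succ_ne_zero
      rw [PowerSeries.coeff_mk]
      push_cast
      field_simp
    simp only [h1]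
    rw [← Finset.mul_sum, ← Finset.sum_range_reflect]
    have h2 := mul_sum_negBinomCoeff θ n
    have h3 : ∑ k ∈ Finset.range (n + 1), negBinomCoeff θ k =
        ∑ j ∈ Finset.range (n + 1), negBinomCoeff θ (n - (n + 1 - 1 - j)) :=
      Finset.sum_congr rfl fun k hk => by
        rw [Finset.mem_range] at hk
        congr 1; omega
    rw [h3] at h2
    exact_mod_cast h2.symm

/-- Euler's limit for Γ. The product in `Real.GammaSeq` has the extra factor θ + n, which accounts
for n / (n + θ). -/
lemma tendsto_negBinomCoeff {θ : ℝ} (hθ : 0 < θ) :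
    Tendsto (fun n : ℕ => negBinomCoeff θ n / (n : ℝ) ^ (θ - 1)) atTop
      (𝓝 (Real.Gamma θ)⁻¹) := by
  have h1 := (Real.GammaSeq_tendsto_Gamma θ).inv₀ (Real.Gamma_pos_of_pos hθ).ne'
  have h2 : Tendsto (fun n : ℕ => (n : ℝ) / (n + θ)) atTop (𝓝 1) :=
    tendsto_natCast_div_add_atTop θ
  have h3 := h2.mul h1
  rw [one_mul] at h3
  refine h3.congr' ?_
  filter_upwards [eventually_gt_atTop 0] with n hn
  have hn' : (0 : ℝ) < n := by exact_mod_cast hn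
  have hprod : negBinomCoeff θ n =
      (∏ j ∈ Finset.range n, (θ + j)) / n.factorial := by
    rw [negBinomCoeff, Finset.prod_div_distrib, ← Finset.prod_range_add_one_eq_factorial]
    push_cast; rfl
  rw [hprod, Real.GammaSeq, Finset.prod_range_succ, Real.rpow_sub_one hn'.ne']
  have h4 : (n : ℝ) ^ θ ≠ 0 := (Real.rpow_pos_of_pos hn' _).ne'
  have h5 : ∏ j ∈ Finset.range n, (θ + (j : ℝ)) ≠ 0 :=
    Finset.prod_ne_zero_iff.2 fun j _ => by positivity
  have h6 : θ + n ≠ 0 := by positivity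
  field_simp
  ring

lemma negBinomCoeff_isBigO {θ : ℝ} (hθ : 0 < θ) :
    negBinomCoeff θ =O[atTop] fun n : ℕ => (n : ℝ) ^ (θ - 1) := by
  refine isBigO_of_div_tendsto_nhds ?_ _ (tendsto_negBinomCoeff hθ)
  filter_upwards [eventually_gt_atTop 0] with n hn h
  exact absurd h (Real.rpow_pos_of_pos (by exact_mod_cast hn) _).ne'

lemma isBigO_negBinomCoeff {θ : ℝ} (hθ : 0 < θ) :
    (fun n : ℕ => (n : ℝ) ^ (θ - 1)) =O[atTop] negBinomCoeff θ := by
  have h := (tendsto_negBinomCoeff hθ).inv₀ (inv_pos.2 (Real.Gamma_pos_of_pos hθ)).ne'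
  refine isBigO_of_div_tendsto_nhds ?_ _ (h.congr fun n => ?_)
  · exact Eventually.of_forall fun n h => absurd h (negBinomCoeff_pos hθ n).ne'
  · simp

/-- Powers of `n` and of `n + 1` are comparable. -/
lemma isBigO_rpow_add_one (α : ℝ) :
    (fun n : ℕ => (n : ℝ) ^ α) =O[atTop] fun n : ℕ => ((n : ℝ) + 1) ^ α := by
  have h : Tendsto (fun n : ℕ => ((n : ℝ) / (n + 1)) ^ α) atTop (𝓝 (1 ^ α)) :=
    (tendsto_natCast_div_add_atTop (1 : ℝ)).rpow_const (Or.inl one_ne_zero)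
  refine isBigO_of_div_tendsto_nhds ?_ _ (h.congr fun n => ?_)
  · exact Eventually.of_forall fun n h => absurd h (by positivity)
  · rw [Pi.div_apply, Real.div_rpow (by positivity) (by positivity)]

lemma isBigO_add_one_rpow (α : ℝ) :
    (fun n : ℕ => ((n : ℝ) + 1) ^ α) =O[atTop] fun n : ℕ => (n : ℝ) ^ α := by
  have h : Tendsto (fun n : ℕ => ((n : ℝ) / (n + 1)) ^ (-α)) atTop (𝓝 (1 ^ (-α))) :=
    (tendsto_natCast_div_add_atTop (1 : ℝ)).rpow_const (Or.inl one_ne_zero)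
  refine isBigO_of_div_tendsto_nhds ?_ _ (h.congr fun n => ?_)
  · filter_upwards [eventually_gt_atTop 0] with n hn h
    exact absurd h (Real.rpow_pos_of_pos (by exact_mod_cast hn) _).ne'
  · rw [Pi.div_apply, Real.rpow_neg (by positivity),
      Real.div_rpow (by positivity) (by positivity), inv_div]

/-- A bound at infinity by a power gives a bound everywhere. -/
lemma exists_forall_norm_le_of_isBigO {E : Type*} [NormedAddCommGroup E] {u : ℕ → E} {α : ℝ}
    (h : u =O[atTop] fun n : ℕ => (n : ℝ) ^ α) :
    ∃ C, 0 < C ∧ ∀ n : ℕ, ‖u n‖ ≤ C * ((n : ℝ) + 1) ^ α := by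
  have h1 := h.trans (isBigO_rpow_add_one α)
  rw [isBigO_nat_atTop_iff fun n h => absurd h (by positivity)] at h1
  obtain ⟨C, hC⟩ := h1
  refine ⟨max C 1, by positivity, fun n => (hC n).trans ?_⟩
  rw [Real.norm_of_nonneg (by positivity)]
  gcongr
  exact le_max_left _ _

lemma negBinomCoeff_le {θ : ℝ} (hθ : 0 < θ) :
    ∃ C, 0 < C ∧ ∀ n : ℕ, negBinomCoeff θ n ≤ C * ((n : ℝ) + 1) ^ (θ - 1) := by
  obtain ⟨C, h0, hC⟩ := exists_forall_norm_le_of_isBigO (negBinomCoeff_isBigO hθ)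
  exact ⟨C, h0, fun n => (le_abs_self _).trans (hC n)⟩

/-- `(n + 1) / 2 ≤ m + 1 ≤ n + 1` makes powers comparable. -/
lemma rpow_le_of_half_le {x y : ℝ} (α : ℝ) (hy : 0 < y) (h1 : y / 2 ≤ x) (h2 : x ≤ y) :
    x ^ α ≤ 2 ^ |α| * y ^ α := by
  have hx : 0 < x := by linarith
  rcases le_or_gt 0 α with h | h
  · rw [abs_of_nonneg h]
    have : (1 : ℝ) ≤ 2 ^ α := Real.one_le_rpow one_le_two h
    calc x ^ α ≤ y ^ α := Real.rpow_le_rpow hx.le h2 h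
      _ ≤ 2 ^ α * y ^ α := le_mul_of_one_le_left (by positivity) this
  · rw [abs_of_neg h]
    calc x ^ α ≤ (y / 2) ^ α := Real.rpow_le_rpow_of_nonpos (by linarith) h1 h.le
      _ = 2 ^ (-α) * y ^ α := by
        rw [Real.div_rpow hy.le zero_le_two, Real.rpow_neg zero_le_two]; ring

/-- Consecutive coefficients differ by (θ - 1) a_m / (m + 1) up to sign, so k steps are summed. The
condition 2k ≤ n keeps all indices in [n/2, n], where powers are comparable whatever the sign of the
exponent. -/
lemma abs_negBinomCoeff_sub_le {θ : ℝ} (hθ : 0 < θ) :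
    ∃ C, 0 < C ∧ ∀ n k : ℕ, 2 * k ≤ n →
      |negBinomCoeff θ (n - k) - negBinomCoeff θ n| ≤ C * k * ((n : ℝ) + 1) ^ (θ - 2) := by
  obtain ⟨C, h0, hC⟩ := negBinomCoeff_le hθ
  refine ⟨C * (|θ - 1| + 1) * 2 ^ |θ - 2|, by positivity, fun n k hk => ?_⟩
  have hstep (m : ℕ) : |negBinomCoeff θ m - negBinomCoeff θ (m + 1)| ≤
      C * (|θ - 1| + 1) * ((m : ℝ) + 1) ^ (θ - 2) := by
    have e : negBinomCoeff θ m - negBinomCoeff θ (m + 1) =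
        -((θ - 1) * (negBinomCoeff θ m / (m + 1))) := by
      rw [negBinomCoeff_succ]
      have : (m + 1 : ℝ) ≠ 0 := by positivity
      field_simp
      ring
    rw [e, abs_neg, abs_mul, abs_of_pos (div_pos (negBinomCoeff_pos hθ m) (by positivity))]
    have e2 : ((m : ℝ) + 1) ^ (θ - 2) = ((m : ℝ) + 1) ^ (θ - 1) / (m + 1) := by
      rw [← Real.rpow_sub_one (by positivity)]; congr 1; ring
    rw [e2]
    calc |θ - 1| * (negBinomCoeff θ m / (m + 1))
        ≤ (|θ - 1| + 1) * (C * ((m : ℝ) + 1) ^ (θ - 1) / (m + 1)) := by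
          gcongr
          · exact (div_pos (negBinomCoeff_pos hθ m) (by positivity)).le
          · linarith
          · exact hC m
      _ = _ := by ring
  have key : ∀ j : ℕ, j ≤ k → |negBinomCoeff θ (n - j) - negBinomCoeff θ n| ≤
      j * (C * (|θ - 1| + 1) * (2 ^ |θ - 2| * ((n : ℝ) + 1) ^ (θ - 2))) := by
    intro j
    induction j with
    | zero => simp
    | succ j ih =>
      intro hj
      have h1 := ih (by omega)
      have h2 := hstep (n - (j + 1))
      rw [show n - (j + 1) + 1 = n - j by omega] at h2
      have h3 : (((n - (j + 1) : ℕ) : ℝ) + 1) ^ (θ - 2) ≤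
          2 ^ |θ - 2| * ((n : ℝ) + 1) ^ (θ - 2) := by
        have e : ((n - (j + 1) : ℕ) : ℝ) = n - (j + 1) := by
          rw [Nat.cast_sub (by omega)]; push_cast; ring
        have hjn : (2 : ℝ) * (j + 1) ≤ n := by exact_mod_cast (by omega : 2 * (j + 1) ≤ n)
        refine rpow_le_of_half_le _ (by positivity) ?_ ?_ <;> rw [e]
        · linarith
        · linarith [(Nat.cast_nonneg j : (0 : ℝ) ≤ j)]
      have h4 : |negBinomCoeff θ (n - (j + 1)) - negBinomCoeff θ (n - j)| ≤
          C * (|θ - 1| + 1) * (2 ^ |θ - 2| * ((n : ℝ) + 1) ^ (θ - 2)) :=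
        h2.trans (by gcongr)
      have h5 := abs_sub_le (negBinomCoeff θ (n - (j + 1))) (negBinomCoeff θ (n - j))
        (negBinomCoeff θ n)
      push_cast
      linarith
  refine (key k le_rfl).trans (le_of_eq ?_)
  ring

/-! ### Power series with coefficients O(n^(-1-γ)) -/

/-- The summable weight `(n + 1) ^ (-1 - γ)`. -/
def decay (γ : ℝ) (n : ℕ) : ℝ := ((n : ℝ) + 1) ^ (-1 - γ)

lemma decay_pos (γ : ℝ) (n : ℕ) : 0 < decay γ n := Real.rpow_pos_of_pos (by positivity) _

lemma summable_decay {γ : ℝ} (hγ : 0 < γ) : Summable (decay γ) := by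
  have h := (summable_nat_add_iff 1).2 (Real.summable_nat_rpow.2 (by linarith : -1 - γ < -1))
  refine h.congr fun n => ?_
  simp [decay]

/-- The larger of k and n - k is at least n/2, so its weight is comparable to that of n. -/
lemma decay_mul_decay_le {γ : ℝ} (hγ : 0 < γ) {n k : ℕ} (hk : k ≤ n) :
    decay γ k * decay γ (n - k) ≤ 2 ^ (1 + γ) * decay γ n * (decay γ k + decay γ (n - k)) := by
  have key : ∀ i j : ℕ, i + j = n → i ≤ j →
      decay γ i * decay γ j ≤ 2 ^ (1 + γ) * decay γ n * (decay γ i + decay γ j) := by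
    intro i j hij hle
    have h1 : decay γ j ≤ 2 ^ (1 + γ) * decay γ n := by
      have hn : (n : ℝ) = i + j := by rw [← hij]; push_cast; rfl
      have hle' : (i : ℝ) ≤ j := by exact_mod_cast hle
      have h := rpow_le_of_half_le (x := (j : ℝ) + 1) (y := (n : ℝ) + 1) (-1 - γ) (by positivity)
        (by rw [hn]; linarith) (by rw [hn]; linarith [(Nat.cast_nonneg i : (0 : ℝ) ≤ i)])
      rwa [abs_of_neg (by linarith), show -(-1 - γ) = 1 + γ by ring] at h
    calc decay γ i * decay γ j ≤ decay γ i * (2 ^ (1 + γ) * decay γ n) := by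
          gcongr; exact (decay_pos γ i).le
      _ ≤ _ := by
        have : 0 < 2 ^ (1 + γ) * decay γ n * decay γ j :=
          mul_pos (mul_pos (by positivity) (decay_pos γ n)) (decay_pos γ j)
        linarith
  rcases le_total k (n - k) with h | h
  · exact key k (n - k) (by omega) h
  · have := key (n - k) k (by omega) h
    rwa [mul_comm (decay γ k), add_comm (decay γ k)]

/-- After the factor `decay γ n` is taken out, what remains is bounded by twice the total mass. This
makes `HasDecay` stable under products. -/
lemma sum_decay_mul_decay_le {γ : ℝ} (hγ : 0 < γ) :
    ∃ C, 0 < C ∧ ∀ n : ℕ,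
      ∑ k ∈ Finset.range (n + 1), decay γ k * decay γ (n - k) ≤ C * decay γ n := by
  have hs := summable_decay hγ
  have hpos : 0 < ∑' k, decay γ k := hs.tsum_pos (fun k => (decay_pos γ k).le) 0 (decay_pos γ 0)
  refine ⟨2 ^ (1 + γ) * (2 * ∑' k, decay γ k), by positivity, fun n => ?_⟩
  have h1 : ∑ k ∈ Finset.range (n + 1), decay γ k ≤ ∑' k, decay γ k :=
    hs.sum_le_tsum _ fun k _ => (decay_pos γ k).le
  have h2 : ∑ k ∈ Finset.range (n + 1), decay γ (n - k) ≤ ∑' k, decay γ k := by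
    have := Finset.sum_range_reflect (decay γ) (n + 1)
    simp only [Nat.add_sub_cancel] at this
    rwa [this]
  calc ∑ k ∈ Finset.range (n + 1), decay γ k * decay γ (n - k)
      ≤ ∑ k ∈ Finset.range (n + 1), 2 ^ (1 + γ) * decay γ n * (decay γ k + decay γ (n - k)) :=
        Finset.sum_le_sum fun k hk => decay_mul_decay_le hγ (by rw [Finset.mem_range] at hk; omega)
    _ = 2 ^ (1 + γ) * decay γ n * (∑ k ∈ Finset.range (n + 1), decay γ k +
          ∑ k ∈ Finset.range (n + 1), decay γ (n - k)) := by
        rw [← Finset.mul_sum, Finset.sum_add_distrib]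
    _ ≤ 2 ^ (1 + γ) * decay γ n * (2 * ∑' k, decay γ k) := by
        have := decay_pos γ n
        gcongr
        linarith
    _ = _ := by ring

/-- The coefficients of the power series are bounded by a multiple of `decay γ`. -/
def HasDecay (γ : ℝ) (f : PowerSeries ℂ) : Prop :=
  ∃ A, 0 ≤ A ∧ ∀ n, ‖PowerSeries.coeff n f‖ ≤ A * decay γ n

lemma HasDecay.mul {γ : ℝ} (hγ : 0 < γ) {f g : PowerSeries ℂ} (hf : HasDecay γ f)
    (hg : HasDecay γ g) : HasDecay γ (f * g) := by
  obtain ⟨C, hC0, hC⟩ := sum_decay_mul_decay_le hγ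
  obtain ⟨A, hA0, hA⟩ := hf
  obtain ⟨B, hB0, hB⟩ := hg
  refine ⟨A * B * C, by positivity, fun n => ?_⟩
  rw [PowerSeries.coeff_mul, Finset.Nat.sum_antidiagonal_eq_sum_range_succ_mk]
  calc _ ≤ ∑ k ∈ Finset.range (n + 1), ‖PowerSeries.coeff k f * PowerSeries.coeff (n - k) g‖ :=
        norm_sum_le _ _
    _ ≤ ∑ k ∈ Finset.range (n + 1), A * B * (decay γ k * decay γ (n - k)) :=
        Finset.sum_le_sum fun k _ => by
          rw [norm_mul]
          calc _ ≤ (A * decay γ k) * (B * decay γ (n - k)) :=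
                mul_le_mul (hA k) (hB _) (norm_nonneg _) (mul_nonneg hA0 (decay_pos γ k).le)
            _ = _ := by ring
    _ ≤ A * B * (C * decay γ n) := by
        rw [← Finset.mul_sum]
        exact mul_le_mul_of_nonneg_left (hC n) (by positivity)
    _ = _ := by ring

lemma HasDecay.pow {γ : ℝ} (hγ : 0 < γ) {f : PowerSeries ℂ} (hf : HasDecay γ f) (N : ℕ) :
    HasDecay γ (f ^ N) := by
  induction N with
  | zero =>
    refine ⟨1, zero_le_one, fun n => ?_⟩
    rw [pow_zero, PowerSeries.coeff_one]
    split_ifs with h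
    · simp [h, decay]
    · simpa using (decay_pos γ n).le
  | succ N ih => rw [pow_succ]; exact ih.mul hγ hf

lemma taylor_const_mul {g : ℂ → ℂ} (c : ℂ) (n : ℕ) :
    PowerSeries.coeff n (taylor fun z => c * g z) = c * PowerSeries.coeff n (taylor g) := by
  simp [taylor, mul_div_assoc]

/-- If the coefficients of `g` decay fast enough, so do those of `exp ∘ g`, provided that the
coefficients of `g` are small. -/
lemma hasDecay_taylor_exp_of_small {γ : ℝ} {g : ℂ → ℂ} (hg : AnalyticAt ℂ g 0) {A C : ℝ}
    (hC : ∀ n : ℕ, ∑ k ∈ Finset.range (n + 1), decay γ k * decay γ (n - k) ≤ C * decay γ n)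
    (hA0 : 0 ≤ A) (hA : ∀ n, ‖PowerSeries.coeff n (taylor g)‖ ≤ A * decay γ n) (hAC : A * C ≤ 1) :
    HasDecay γ (taylor fun z => Complex.exp (g z)) := by
  set e : ℕ → ℂ := fun n => PowerSeries.coeff n (taylor fun z => Complex.exp (g z)) with he
  refine ⟨‖e 0‖, norm_nonneg _, fun n => ?_⟩
  induction n using Nat.strong_induction_on with
  | _ n ih =>
    rcases n with _ | n
    · simp [decay, he]
    · have h1 := coeff_taylor_exp_succ hg n
      have hn : (0 : ℝ) < n + 1 := by positivity
      -- The factor k + 1 coming from g' is at most n + 1 and so cancels against the left side.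
      have h2 : ((n : ℝ) + 1) * ‖e (n + 1)‖ ≤ ∑ k ∈ Finset.range (n + 1),
          ((n : ℝ) + 1) * (A * ‖e 0‖ * (decay γ (k + 1) * decay γ (n - k))) := by
        have h3 : ((n : ℝ) + 1) * ‖e (n + 1)‖ = ‖((n : ℂ) + 1) * e (n + 1)‖ := by
          rw [norm_mul, show ((n : ℂ) + 1) = ((n + 1 : ℕ) : ℂ) by push_cast; rfl,
            Complex.norm_natCast]
          push_cast; rfl
        rw [h3, h1]
        refine (norm_sum_le _ _).trans (Finset.sum_le_sum fun k hk => ?_)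
        rw [Finset.mem_range] at hk
        rw [norm_mul, norm_mul, show ((k : ℂ) + 1) = ((k + 1 : ℕ) : ℂ) by push_cast; rfl,
            Complex.norm_natCast]
        have h4 := ih (n - k) (by omega)
        calc _ ≤ ((n : ℝ) + 1) * (A * decay γ (k + 1)) * (‖e 0‖ * decay γ (n - k)) := by
              refine mul_le_mul (mul_le_mul ?_ (hA _) (norm_nonneg _) hn.le) h4 (norm_nonneg _) ?_
              · exact_mod_cast hk
              · have := decay_pos γ (k + 1); positivity
          _ = _ := by ring
      rw [← Finset.mul_sum, ← Finset.mul_sum] at h2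
      have h5 := le_of_mul_le_mul_left h2 hn
      -- This is the convolution at n + 1 without its first term.
      have h6 : ∑ k ∈ Finset.range (n + 1), decay γ (k + 1) * decay γ (n - k) ≤
          C * decay γ (n + 1) := by
        refine le_trans ?_ (hC (n + 1))
        rw [Finset.sum_range_succ' _ (n + 1)]
        simp only [Nat.add_sub_add_right]
        have := mul_pos (decay_pos γ 0) (decay_pos γ (n + 1 - 0))
        linarith
      calc ‖e (n + 1)‖ ≤ A * ‖e 0‖ * (C * decay γ (n + 1)) :=
            h5.trans (mul_le_mul_of_nonneg_left h6 (by positivity))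
        _ = (A * C) * (‖e 0‖ * decay γ (n + 1)) := by ring
        _ ≤ 1 * (‖e 0‖ * decay γ (n + 1)) := by
            have := decay_pos γ (n + 1)
            gcongr
        _ = _ := one_mul _

lemma taylor_exp_pow {g : ℂ → ℂ} (hg : AnalyticAt ℂ g 0) (N : ℕ) :
    (taylor fun z => Complex.exp (g z)) ^ N = taylor fun z => Complex.exp (N * g z) := by
  induction N with
  | zero =>
    simp only [pow_zero, Nat.cast_zero, zero_mul, Complex.exp_zero]
    ext n
    rw [taylor, PowerSeries.coeff_one, PowerSeries.coeff_mk, iteratedDeriv_const]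
    split_ifs with h <;> simp [h]
  | succ N ih =>
    have h : AnalyticAt ℂ (fun z => (N : ℂ) * g z) 0 := analyticAt_const.mul hg
    rw [pow_succ, ih, ← taylor_mul (F := fun z => Complex.exp (N * g z))
      (G := fun z => Complex.exp (g z)) h.cexp hg.cexp]
    congr 1
    ext z
    rw [← Complex.exp_add]
    push_cast
    ring_nf

/-- Smallness is obtained by scaling: g/N satisfies A C / N ≤ 1 for large N, and exp(g) = exp(g/N)^N
is a power of a series with decay. -/
lemma hasDecay_taylor_exp {γ : ℝ} (hγ : 0 < γ) {g : ℂ → ℂ} (hg : AnalyticAt ℂ g 0)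
    (h : HasDecay γ (taylor g)) : HasDecay γ (taylor fun z => Complex.exp (g z)) := by
  obtain ⟨C, hC0, hC⟩ := sum_decay_mul_decay_le hγ
  obtain ⟨A, hA0, hA⟩ := h
  obtain ⟨N, hN⟩ := exists_nat_ge (A * C + 1)
  have hAC : 0 ≤ A * C := by positivity
  have hN0 : (0 : ℝ) < N := by linarith
  have hNc : (N : ℂ) ≠ 0 := by
    have : N ≠ 0 := by rintro rfl; simp at hN0
    exact_mod_cast this
  have hgN : AnalyticAt ℂ (fun z => (N : ℂ)⁻¹ * g z) 0 := analyticAt_const.mul hg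
  have hsmall : HasDecay γ (taylor fun z => Complex.exp ((N : ℂ)⁻¹ * g z)) := by
    refine hasDecay_taylor_exp_of_small hgN (A := A / N) hC (by positivity)
      (fun n => ?_) ?_
    · rw [taylor_const_mul, norm_mul, norm_inv, Complex.norm_natCast, div_mul_eq_mul_div,
        ← div_eq_inv_mul]
      exact div_le_div_of_nonneg_right (hA n) hN0.le
    · rw [div_mul_eq_mul_div, div_le_one hN0]; linarith
  have := hsmall.pow hγ N
  rw [taylor_exp_pow hgN] at this
  simpa only [mul_inv_cancel_left₀ hNc] using this

lemma HasDecay.summable {γ : ℝ} (hγ : 0 < γ) {f : PowerSeries ℂ} (hf : HasDecay γ f) :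
    Summable fun n => PowerSeries.coeff n f := by
  obtain ⟨A, _, hA⟩ := hf
  exact Summable.of_norm_bounded ((summable_decay hγ).mul_left A) hA

/-! ### Boundary values and tail sums -/

/-- Abel's theorem: the value at `1` of a summable Taylor series. -/
lemma tendsto_of_summable_taylor {g : ℂ → ℂ} (hg : DifferentiableOn ℂ g (Metric.ball 0 1))
    (hs : Summable fun n => PowerSeries.coeff n (taylor g)) :
    Tendsto g ((𝓝[<] (1 : ℝ)).map Complex.ofReal)
      (𝓝 (∑' n, PowerSeries.coeff n (taylor g))) := by
  refine (Complex.tendsto_tsum_powerSeries_nhdsWithin_lt hs.hasSum.tendsto_sum_nat).congr' ?_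
  rw [EventuallyEq, eventually_map]
  filter_upwards [Ioo_mem_nhdsLT (zero_lt_one : (0 : ℝ) < 1)] with x hx
  have hx' : (x : ℂ) ∈ Metric.ball (0 : ℂ) 1 := by
    simpa [abs_of_pos hx.1] using hx.2
  have := Complex.hasSum_taylorSeries_on_ball hg hx'
  rw [← this.tsum_eq]
  refine tsum_congr fun n => ?_
  simp only [taylor, PowerSeries.coeff_mk, sub_zero, smul_eq_mul]
  ring

/-- Both sides are the radial limit of exp ∘ g at 1, by Abel's theorem for exp ∘ g and for g. -/
lemma tsum_coeff_taylor_exp {g : ℂ → ℂ} (hg : DifferentiableOn ℂ g (Metric.ball 0 1))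
    (hs : Summable fun n => PowerSeries.coeff n (taylor g))
    (he : Summable fun n => PowerSeries.coeff n (taylor fun z => Complex.exp (g z))) :
    ∑' n, PowerSeries.coeff n (taylor fun z => Complex.exp (g z)) =
      Complex.exp (∑' n, PowerSeries.coeff n (taylor g)) := by
  refine tendsto_nhds_unique (tendsto_of_summable_taylor hg.cexp he) ?_
  exact (Complex.continuous_exp.tendsto _).comp (tendsto_of_summable_taylor hg hs)

/-- Comparison with the integral of x^(-1-γ), carried out by telescoping x^(-γ)/γ. -/
lemma tsum_decay_tail_le {γ : ℝ} (hγ : 0 < γ) (n : ℕ) :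
    ∑' k, decay γ (k + (n + 1)) ≤ γ⁻¹ * ((n : ℝ) + 1) ^ (-γ) := by
  have hstep (x : ℝ) (hx : 0 < x) :
      (x + 1) ^ (-1 - γ) ≤ γ⁻¹ * (x ^ (-γ) - (x + 1) ^ (-γ)) := by
    have hx1 : 0 < x + 1 := by linarith
    -- A Bernoulli inequality for the exponent -γ, from log y ≤ y - 1 and 1 + u ≤ exp u.
    have h1 : 1 + γ / (x + 1) ≤ (x / (x + 1)) ^ (-γ) := by
      rw [Real.rpow_def_of_pos (by positivity)]
      have h2 : Real.log (x / (x + 1)) ≤ x / (x + 1) - 1 :=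
        Real.log_le_sub_one_of_pos (by positivity)
      have h3 : x / (x + 1) - 1 = -(1 / (x + 1)) := by field_simp; ring
      have h4 : γ / (x + 1) ≤ Real.log (x / (x + 1)) * -γ := by
        rw [h3] at h2
        have := mul_le_mul_of_nonneg_left h2 hγ.le
        have h5 : γ * -(1 / (x + 1)) = -(γ / (x + 1)) := by ring
        linarith
      calc _ ≤ γ / (x + 1) + 1 := by linarith
        _ ≤ Real.exp (γ / (x + 1)) := Real.add_one_le_exp _
        _ ≤ _ := Real.exp_le_exp.2 h4
    have h6 : x ^ (-γ) = (x / (x + 1)) ^ (-γ) * (x + 1) ^ (-γ) := by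
      rw [← Real.mul_rpow (by positivity) hx1.le, div_mul_cancel₀ _ hx1.ne']
    have h7 : (x + 1) ^ (-1 - γ) = (x + 1) ^ (-γ) / (x + 1) := by
      rw [← Real.rpow_sub_one hx1.ne']; congr 1; ring
    have h8 := mul_le_mul_of_nonneg_right h1 (Real.rpow_pos_of_pos hx1 (-γ)).le
    rw [← h6] at h8
    rw [h7, ← div_eq_inv_mul, le_div_iff₀ hγ]
    have : (1 + γ / (x + 1)) * (x + 1) ^ (-γ) =
      (x + 1) ^ (-γ) + (x + 1) ^ (-γ) / (x + 1) * γ := by ring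
    linarith
  have hsum (m : ℕ) : ∑ k ∈ Finset.range m, decay γ (k + (n + 1)) ≤
      γ⁻¹ * (((n : ℝ) + 1) ^ (-γ) - ((m : ℝ) + (n + 1)) ^ (-γ)) := by
    induction m with
    | zero => simp
    | succ m ih =>
      rw [Finset.sum_range_succ]
      have := hstep ((m : ℝ) + (n + 1)) (by positivity)
      simp only [decay] at ih ⊢
      push_cast at ih ⊢
      rw [show (m : ℝ) + 1 + (n + 1) = m + (n + 1) + 1 by ring]
      rw [mul_sub] at *
      linarith
  refine Real.tsum_le_of_sum_range_le (fun k => (decay_pos γ _).le) fun m => (hsum m).trans ?_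
  have : 0 ≤ ((m : ℝ) + (n + 1)) ^ (-γ) := by positivity
  have hg : 0 < γ⁻¹ := inv_pos.2 hγ
  exact mul_le_mul_of_nonneg_left (by linarith) hg.le

/-- The source of the logarithm: each term is at most (n + 1)^(1-γ) / (k + 1), which leaves a
harmonic sum. The bound uses that 1 - γ is nonnegative. -/
lemma sum_mul_decay_le {γ : ℝ} (hγ1 : γ ≤ 1) (n : ℕ) :
    ∑ k ∈ Finset.range (n + 1), (k : ℝ) * decay γ k ≤
      ((n : ℝ) + 1) ^ (1 - γ) * (1 + Real.log (n + 1)) := by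
  have h1 : ∀ k ∈ Finset.range (n + 1), (k : ℝ) * decay γ k ≤
      ((n : ℝ) + 1) ^ (1 - γ) * ((k : ℝ) + 1)⁻¹ := fun k hk => by
    have hk' : (k : ℝ) + 1 ≤ n + 1 := by
      exact_mod_cast (Finset.mem_range.1 hk)
    have hk0 : (0 : ℝ) < k + 1 := by positivity
    have e : decay γ k = ((k : ℝ) + 1) ^ (1 - γ) * ((k : ℝ) + 1)⁻¹ * ((k : ℝ) + 1)⁻¹ := by
      rw [decay, show -1 - γ = 1 - γ - 1 - 1 by ring, Real.rpow_sub_one hk0.ne',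
        Real.rpow_sub_one hk0.ne', div_eq_mul_inv, div_eq_mul_inv]
    have h2 : ((k : ℝ) + 1) ^ (1 - γ) ≤ ((n : ℝ) + 1) ^ (1 - γ) :=
      Real.rpow_le_rpow hk0.le hk' (by linarith)
    calc (k : ℝ) * decay γ k ≤ ((k : ℝ) + 1) * decay γ k := by
          have := (decay_pos γ k).le
          gcongr; linarith
      _ = ((k : ℝ) + 1) ^ (1 - γ) * ((k : ℝ) + 1)⁻¹ := by rw [e]; field_simp
      _ ≤ _ := by gcongr
  refine (Finset.sum_le_sum h1).trans ?_
  rw [← Finset.mul_sum]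
  refine mul_le_mul_of_nonneg_left ?_ (by positivity)
  have := harmonic_le_one_add_log (n + 1)
  rw [harmonic] at this
  push_cast at this
  exact this

/-! ### Coefficient asymptotics for the class `eF` -/

/-- Convolution of the coefficients of `(1 - t) ^ (-θ)` with a decaying sequence. -/
lemma exists_norm_convolution_sub_le {θ γ : ℝ} (hθ : 0 < θ) (hγ : 0 < γ) (hγ1 : γ ≤ 1)
    {e : PowerSeries ℂ} (he : HasDecay γ e) :
    ∃ C, ∀ n : ℕ, ‖∑ k ∈ Finset.range (n + 1),
        (negBinomCoeff θ (n - k) : ℂ) * PowerSeries.coeff k e -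
          negBinomCoeff θ n * ∑' k, PowerSeries.coeff k e‖ ≤
      C * (((n : ℝ) + 1) ^ (θ - 1 - γ) * (1 + Real.log (n + 1))) := by
  have hs := he.summable hγ
  obtain ⟨A, hA0, hA⟩ := he
  obtain ⟨B, hB0, hB⟩ := negBinomCoeff_le hθ
  obtain ⟨D, hD0, hD⟩ := abs_negBinomCoeff_sub_le hθ
  set K : ℝ := A * 2 ^ (1 + γ) with hK
  refine ⟨D * A + (K * (2 ^ |θ| * B / θ) + K * B) + B * (A * γ⁻¹), fun n => ?_⟩
  have hn1 : (0 : ℝ) < n + 1 := by positivity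
  have hlog : 0 ≤ Real.log ((n : ℝ) + 1) := Real.log_nonneg (by linarith [(Nat.cast_nonneg n : (0:ℝ) ≤ n)])
  have hpow (x y : ℝ) : ((n : ℝ) + 1) ^ x * ((n : ℝ) + 1) ^ y = ((n : ℝ) + 1) ^ (x + y) :=
    (Real.rpow_add hn1 x y).symm
  have hapos := negBinomCoeff_pos hθ
  have htail : ‖∑' k, PowerSeries.coeff (k + (n + 1)) e‖ ≤
      A * (γ⁻¹ * ((n : ℝ) + 1) ^ (-γ)) := by
    have h1 : Summable fun k => A * decay γ (k + (n + 1)) :=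
      ((summable_nat_add_iff (n + 1)).2 (summable_decay hγ)).mul_left A
    calc _ ≤ ∑' k, A * decay γ (k + (n + 1)) :=
          tsum_of_norm_bounded h1.hasSum fun k => hA _
      _ = A * ∑' k, decay γ (k + (n + 1)) := tsum_mul_left
      _ ≤ _ := mul_le_mul_of_nonneg_left (tsum_decay_tail_le hγ n) hA0
  -- For k ≤ n/2 the difference a_(n-k) - a_n is small, which gives the first summand. For k > n/2
  -- the coefficient of e is already O(n^(-1-γ)), and the difference is bounded by a_(n-k) plus the
  -- bound for a_n.
  have hterm : ∀ k ∈ Finset.range (n + 1),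
      ‖((negBinomCoeff θ (n - k) : ℂ) - negBinomCoeff θ n) * PowerSeries.coeff k e‖ ≤
        D * A * ((n : ℝ) + 1) ^ (θ - 2) * (k * decay γ k) +
          (K * ((n : ℝ) + 1) ^ (-1 - γ) * negBinomCoeff θ (n - k) +
            K * B * ((n : ℝ) + 1) ^ (-1 - γ + (θ - 1))) := by
    intro k hk
    have hkn : k ≤ n := by rw [Finset.mem_range] at hk; omega
    have hdk := decay_pos γ k
    have p1 : 0 ≤ D * A * ((n : ℝ) + 1) ^ (θ - 2) * (k * decay γ k) := by positivity
    have p2 : 0 ≤ K * ((n : ℝ) + 1) ^ (-1 - γ) * negBinomCoeff θ (n - k) := by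
      have := hapos (n - k); positivity
    have p3 : 0 ≤ K * B * ((n : ℝ) + 1) ^ (-1 - γ + (θ - 1)) := by positivity
    rw [norm_mul, ← Complex.ofReal_sub, Complex.norm_real, Real.norm_eq_abs]
    by_cases h : 2 * k ≤ n
    · calc _ ≤ (D * k * ((n : ℝ) + 1) ^ (θ - 2)) * (A * decay γ k) :=
            mul_le_mul (hD n k h) (hA k) (norm_nonneg _) (by positivity)
        _ = D * A * ((n : ℝ) + 1) ^ (θ - 2) * (k * decay γ k) := by ring
        _ ≤ _ := by linarith
    · have h1 : decay γ k ≤ 2 ^ (1 + γ) * ((n : ℝ) + 1) ^ (-1 - γ) := by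
        have hkn' : (k : ℝ) ≤ n := by exact_mod_cast hkn
        have hk2 : (n : ℝ) ≤ 2 * k := by exact_mod_cast (by omega : n ≤ 2 * k)
        have h := rpow_le_of_half_le (x := (k : ℝ) + 1) (y := (n : ℝ) + 1) (-1 - γ) hn1
          (by linarith) (by linarith)
        rwa [abs_of_neg (by linarith), show -(-1 - γ) = 1 + γ by ring] at h
      have h2 : |negBinomCoeff θ (n - k) - negBinomCoeff θ n| ≤
          negBinomCoeff θ (n - k) + B * ((n : ℝ) + 1) ^ (θ - 1) := by
        have := hapos (n - k)
        have := hapos n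
        have := hB n
        rw [abs_le]; constructor <;> linarith
      calc _ ≤ (negBinomCoeff θ (n - k) + B * ((n : ℝ) + 1) ^ (θ - 1)) *
              (A * (2 ^ (1 + γ) * ((n : ℝ) + 1) ^ (-1 - γ))) := by
            refine mul_le_mul h2 ((hA k).trans ?_) (norm_nonneg _) ?_
            · exact mul_le_mul_of_nonneg_left h1 hA0
            · have := hapos (n - k); positivity
        _ = K * ((n : ℝ) + 1) ^ (-1 - γ) * negBinomCoeff θ (n - k) +
            K * B * (((n : ℝ) + 1) ^ (-1 - γ) * ((n : ℝ) + 1) ^ (θ - 1)) := by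
            rw [hK]; ring
        _ ≤ _ := by rw [hpow]; linarith
  have hsuma : ∑ k ∈ Finset.range (n + 1), negBinomCoeff θ (n - k) ≤
      2 ^ |θ| * B / θ * ((n : ℝ) + 1) ^ θ := by
    have h1 : ∑ k ∈ Finset.range (n + 1), negBinomCoeff θ (n - k) =
        ∑ k ∈ Finset.range (n + 1), negBinomCoeff θ k := by
      have := Finset.sum_range_reflect (negBinomCoeff θ) (n + 1)
      simpa only [Nat.add_sub_cancel] using this
    have h2 := mul_sum_negBinomCoeff θ n
    have h3 := hB (n + 1)
    have h4 : ((n : ℝ) + 1 + 1) ^ θ ≤ 2 ^ |θ| * ((n : ℝ) + 1) ^ θ := by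
      rw [abs_of_pos hθ, ← Real.mul_rpow zero_le_two hn1.le]
      exact Real.rpow_le_rpow (by positivity) (by linarith) hθ.le
    rw [h1, div_mul_eq_mul_div, le_div_iff₀ hθ, mul_comm _ θ, h2]
    push_cast at h3
    have hn2 : (0 : ℝ) < n + 1 + 1 := by positivity
    calc ((n : ℝ) + 1) * negBinomCoeff θ (n + 1)
        ≤ ((n : ℝ) + 1 + 1) * (B * ((n : ℝ) + 1 + 1) ^ (θ - 1)) := by
          refine mul_le_mul (by linarith) h3 (hapos _).le hn2.le
      _ = B * ((n : ℝ) + 1 + 1) ^ θ := by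
          rw [Real.rpow_sub_one hn2.ne']; field_simp
      _ ≤ B * (2 ^ |θ| * ((n : ℝ) + 1) ^ θ) := mul_le_mul_of_nonneg_left h4 hB0.le
      _ = _ := by ring
  -- Replacing every a_(n-k) by a_n produces a_n times a partial sum, so the tail of the series is
  -- left over.
  have hsplit : ∑ k ∈ Finset.range (n + 1),
        (negBinomCoeff θ (n - k) : ℂ) * PowerSeries.coeff k e -
          negBinomCoeff θ n * ∑' k, PowerSeries.coeff k e =
      ∑ k ∈ Finset.range (n + 1),
        ((negBinomCoeff θ (n - k) : ℂ) - negBinomCoeff θ n) * PowerSeries.coeff k e -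
          negBinomCoeff θ n * ∑' k, PowerSeries.coeff (k + (n + 1)) e := by
    rw [← hs.sum_add_tsum_nat_add (n + 1), mul_add, Finset.mul_sum]
    simp only [sub_mul, Finset.sum_sub_distrib]
    ring
  set X := ((n : ℝ) + 1) ^ (θ - 1 - γ) with hX
  have hX0 : 0 < X := Real.rpow_pos_of_pos hn1 _
  have b1 : ∑ k ∈ Finset.range (n + 1), D * A * ((n : ℝ) + 1) ^ (θ - 2) * (k * decay γ k) ≤
      D * A * (X * (1 + Real.log (n + 1))) := by
    rw [← Finset.mul_sum]
    calc _ ≤ D * A * ((n : ℝ) + 1) ^ (θ - 2) *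
            (((n : ℝ) + 1) ^ (1 - γ) * (1 + Real.log (n + 1))) :=
          mul_le_mul_of_nonneg_left (sum_mul_decay_le hγ1 n) (by positivity)
      _ = D * A * (((n : ℝ) + 1) ^ (θ - 2) * ((n : ℝ) + 1) ^ (1 - γ) *
            (1 + Real.log (n + 1))) := by ring
      _ = _ := by rw [hpow, hX]; ring_nf
  have b2 : ∑ k ∈ Finset.range (n + 1), K * ((n : ℝ) + 1) ^ (-1 - γ) * negBinomCoeff θ (n - k) ≤
      K * (2 ^ |θ| * B / θ) * X := by
    rw [← Finset.mul_sum]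
    calc _ ≤ K * ((n : ℝ) + 1) ^ (-1 - γ) * (2 ^ |θ| * B / θ * ((n : ℝ) + 1) ^ θ) :=
          mul_le_mul_of_nonneg_left hsuma (by positivity)
      _ = K * (2 ^ |θ| * B / θ) * (((n : ℝ) + 1) ^ (-1 - γ) * ((n : ℝ) + 1) ^ θ) := by ring
      _ = _ := by rw [hpow, hX]; ring_nf
  have b3 : ∑ _k ∈ Finset.range (n + 1), K * B * ((n : ℝ) + 1) ^ (-1 - γ + (θ - 1)) =
      K * B * X := by
    rw [Finset.sum_const, Finset.card_range, nsmul_eq_mul, hX,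
      show θ - 1 - γ = -1 - γ + (θ - 1) + 1 by ring, Real.rpow_add_one hn1.ne']
    push_cast; ring
  have b4 : ‖(negBinomCoeff θ n : ℂ) * ∑' k, PowerSeries.coeff (k + (n + 1)) e‖ ≤
      B * (A * γ⁻¹) * X := by
    rw [norm_mul, Complex.norm_real, Real.norm_of_nonneg (hapos n).le]
    calc _ ≤ (B * ((n : ℝ) + 1) ^ (θ - 1)) * (A * (γ⁻¹ * ((n : ℝ) + 1) ^ (-γ))) :=
          mul_le_mul (hB n) htail (norm_nonneg _) (by positivity)
      _ = B * (A * γ⁻¹) * (((n : ℝ) + 1) ^ (θ - 1) * ((n : ℝ) + 1) ^ (-γ)) := by ring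
      _ = _ := by rw [hpow, hX]; ring_nf
  rw [hsplit]
  refine (norm_sub_le _ _).trans ((add_le_add ((norm_sum_le _ _).trans
    (Finset.sum_le_sum hterm)) b4).trans ?_)
  rw [Finset.sum_add_distrib, Finset.sum_add_distrib, b3]
  have hXL : X ≤ X * (1 + Real.log (n + 1)) := le_mul_of_one_le_right hX0.le (by linarith)
  have q : 0 ≤ K * (2 ^ |θ| * B / θ) + K * B + B * (A * γ⁻¹) := by positivity
  have := mul_le_mul_of_nonneg_left hXL q
  linarith

/-- Transfer for the class `eF(1, θ, γ)`: coefficients of `exp ∘ g`. -/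
lemma coeff_taylor_exp_isBigO_log {θ γ : ℝ} (hθ : 0 < θ) (hγ : 0 < γ) (hγ1 : γ ≤ 1)
    {g₀ : ℂ → ℂ} (hg₀ : DifferentiableOn ℂ g₀ (Metric.ball 0 1)) (hd : HasDecay γ (taylor g₀)) :
    (fun n : ℕ => PowerSeries.coeff n
        (taylor fun z => Complex.exp (θ * Complex.log (1 / (1 - z)) + g₀ z)) -
          negBinomCoeff θ n * Complex.exp (∑' k, PowerSeries.coeff k (taylor g₀)))
      =O[atTop] fun n : ℕ => (n : ℝ) ^ (θ - 1) * (Real.log n / (n : ℝ) ^ γ) := by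
  have hgan : AnalyticAt ℂ g₀ 0 :=
    hg₀.analyticAt (Metric.ball_mem_nhds _ one_pos)
  have hlan : AnalyticAt ℂ (fun z : ℂ => (θ : ℂ) * Complex.log (1 / (1 - z))) 0 :=
    (isExpansionAtZero_log θ).analyticAt
  have hed := hasDecay_taylor_exp hγ hgan hd
  have hmul : taylor (fun z => Complex.exp (θ * Complex.log (1 / (1 - z)) + g₀ z)) =
      taylor (fun z => Complex.exp (g₀ z)) *
        taylor (fun z => Complex.exp (θ * Complex.log (1 / (1 - z)))) := by
    rw [← taylor_mul (F := fun z => Complex.exp (g₀ z))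
      (G := fun z => Complex.exp (θ * Complex.log (1 / (1 - z)))) hgan.cexp hlan.cexp]
    congr 1
    ext z
    rw [add_comm, Complex.exp_add]
  obtain ⟨C, hC⟩ := exists_norm_convolution_sub_le hθ hγ hγ1 hed
  rw [tsum_coeff_taylor_exp hg₀ (hd.summable hγ) (hed.summable hγ)] at hC
  have h1 : (fun n : ℕ => PowerSeries.coeff n
        (taylor fun z => Complex.exp (θ * Complex.log (1 / (1 - z)) + g₀ z)) -
          negBinomCoeff θ n * Complex.exp (∑' k, PowerSeries.coeff k (taylor g₀)))
      =O[atTop] fun n : ℕ => ((n : ℝ) + 1) ^ (θ - 1 - γ) * (1 + Real.log (n + 1)) := by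
    refine IsBigO.of_bound C (Eventually.of_forall fun n => ?_)
    refine le_trans (le_of_eq ?_) ((hC n).trans (le_of_eq ?_))
    · rw [hmul, PowerSeries.coeff_mul, Finset.Nat.sum_antidiagonal_eq_sum_range_succ_mk]
      simp only [coeff_taylor_exp_log]
      congr 2
      exact Finset.sum_congr rfl fun k _ => mul_comm _ _
    · rw [Real.norm_of_nonneg]
      have : 0 ≤ Real.log ((n : ℝ) + 1) :=
        Real.log_nonneg (by linarith [(Nat.cast_nonneg n : (0 : ℝ) ≤ n)])
      positivity
  refine h1.trans (((isBigO_add_one_rpow (θ - 1 - γ)).mul (g₂ := fun n : ℕ => Real.log n) ?_).trans ?_)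
  · refine IsBigO.of_bound 3 ?_
    -- From n = 3 > e on, log n ≥ 1 absorbs the constant, and n + 1 ≤ n² gives log(n + 1) ≤ 2 log n.
    filter_upwards [eventually_ge_atTop 3] with n hn
    have hn' : (3 : ℝ) ≤ n := by exact_mod_cast hn
    have h2 : 1 ≤ Real.log n := by
      rw [Real.le_log_iff_exp_le (by linarith)]
      linarith [Real.exp_one_lt_d9]
    have h3 : Real.log ((n : ℝ) + 1) ≤ 2 * Real.log n := by
      rw [← Real.log_rpow (by linarith) 2]
      refine Real.log_le_log (by linarith) ?_
      rw [Real.rpow_two]; nlinarith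
    have h4 : 0 ≤ Real.log ((n : ℝ) + 1) := Real.log_nonneg (by linarith)
    rw [Real.norm_of_nonneg (by linarith), Real.norm_of_nonneg (by linarith)]
    linarith
  · refine IsBigO.of_bound 1 ?_
    filter_upwards [eventually_gt_atTop 0] with n hn
    have hn' : (0 : ℝ) < n := by exact_mod_cast hn
    rw [one_mul, Real.rpow_sub hn' _ γ]
    apply le_of_eq
    congr 1
    ring

/-! ### Coefficients from growth at the boundary -/

/-- The average of `‖1 - z‖⁻²` over a circle of radius `ρ < 1`. -/
lemma circleAverage_norm_one_sub_inv_sq {ρ : ℝ} (h0 : 0 < ρ) (h1 : ρ < 1) :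
    Real.circleAverage (fun z : ℂ => (‖1 - z‖ ^ 2)⁻¹) 0 ρ = (1 - ρ ^ 2)⁻¹ := by
  -- On the circle ρ² = z z̄, so |z - ρ²| = ρ |1 - z|. The integrand is therefore (1 - ρ²)⁻¹ times
  -- the Poisson kernel at ρ², whose mean is 1.
  have hw : ((ρ ^ 2 : ℝ) : ℂ) ∈ Metric.ball (0 : ℂ) ρ := by
    rw [mem_ball_zero_iff, Complex.norm_real, Real.norm_of_nonneg (by positivity)]
    nlinarith
  have hP := (InnerProductSpace.HarmonicOnNhd.circleAverage_poissonKernel_smul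
    (f := fun _ : ℂ => (1 : ℝ)) (c := 0) (R := ρ)
    (fun z _ => InnerProductSpace.harmonicAt_const (1 : ℝ)) hw)
  have hE : Set.EqOn (fun z : ℂ => (‖1 - z‖ ^ 2)⁻¹)
      ((1 - ρ ^ 2)⁻¹ • (poissonKernel 0 ((ρ ^ 2 : ℝ) : ℂ) • fun _ : ℂ => (1 : ℝ)))
      (Metric.sphere 0 |ρ|) := by
    intro z hz
    have hz : ‖z‖ = ρ := by simpa [abs_of_pos h0] using hz
    have hz2 : z * (starRingEnd ℂ) z = ((ρ ^ 2 : ℝ) : ℂ) := by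
      rw [Complex.mul_conj, Complex.normSq_eq_norm_sq, hz]
    have e1 : ‖z - ((ρ ^ 2 : ℝ) : ℂ)‖ = ρ * ‖1 - z‖ := by
      rw [← hz2, show z - z * (starRingEnd ℂ) z = z * (starRingEnd ℂ) (1 - z) by
        simp [map_sub]; ring, norm_mul, RCLike.norm_conj, hz]
    have e2 : ‖((ρ ^ 2 : ℝ) : ℂ)‖ = ρ ^ 2 := by
      rw [Complex.norm_real, Real.norm_of_nonneg (by positivity)]
    have hne : ‖1 - z‖ ≠ 0 := by
      rw [norm_ne_zero_iff, sub_ne_zero]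
      rintro rfl
      simp at hz; linarith
    have hρ : 1 - ρ ^ 2 ≠ 0 := by nlinarith
    change (‖1 - z‖ ^ 2)⁻¹ = (1 - ρ ^ 2)⁻¹ * (poissonKernel 0 ((ρ ^ 2 : ℝ) : ℂ) z * 1)
    simp only [mul_one, poissonKernel_def, sub_zero, e1, e2, hz]
    have : ρ ≠ 0 := h0.ne'
    field_simp
  rw [Real.circleAverage_congr_sphere hE, Real.circleAverage_smul, hP]
  simp

/-- Cauchy's formula, keeping the mean of |F| over the circle. A supremum would lose a power of n
for functions singular only at 1. -/
lemma norm_coeff_taylor_le {F : ℂ → ℂ} (hF : DifferentiableOn ℂ F (Metric.ball 0 1)) {ρ : ℝ}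
    (h0 : 0 < ρ) (h1 : ρ < 1) (m : ℕ) :
    ‖PowerSeries.coeff m (taylor F)‖ ≤ Real.circleAverage (fun z => ‖F z‖) 0 ρ * ρ⁻¹ ^ m := by
  lift ρ to NNReal using h0.le
  have hcl : Metric.closedBall (0 : ℂ) ρ ⊆ Metric.ball 0 1 := Metric.closedBall_subset_ball h1
  have hd : DiffContOnCl ℂ F (Metric.ball 0 ρ) :=
    (hF.mono ((Metric.closure_ball_subset_closedBall).trans hcl)).diffContOnCl
  have hp := DiffContOnCl.hasFPowerSeriesOnBall hd (NNReal.coe_pos.1 h0)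
  have hT : HasFPowerSeriesAt F _ 0 := isExpansionAtZero_iff.1
    (isExpansionAtZero_taylor (hF.analyticAt (Metric.ball_mem_nhds _ one_pos)))
  have heq := hT.eq_formalMultilinearSeries hp.hasFPowerSeriesAt
  have hn := norm_cauchyPowerSeries_le F 0 ρ m
  have h2 : ‖PowerSeries.coeff m (taylor F)‖ = ‖cauchyPowerSeries F 0 ρ m‖ := by
    rw [← heq, FormalMultilinearSeries.ofScalars_norm]
  rw [h2]
  refine hn.trans (le_of_eq ?_)
  rw [Real.circleAverage_def, smul_eq_mul, abs_of_pos h0]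

/-- Coefficients of a function on the unit disc with polynomial growth at the point `1`. -/
lemma coeff_taylor_isBigO_of_growth {F : ℂ → ℂ} (hF : DifferentiableOn ℂ F (Metric.ball 0 1))
    {M β : ℝ} (hβ : 2 ≤ β)
    (hM : ∀ z ∈ Metric.ball (0 : ℂ) 1, ‖F z‖ ≤ M * ‖1 - z‖ ^ (-β)) :
    (fun m : ℕ => PowerSeries.coeff m (taylor F)) =O[atTop] fun m : ℕ => (m : ℝ) ^ (β - 1) := by
  have hM0 : 0 ≤ M := by simpa using (norm_nonneg _).trans (hM 0 (by simp))
  have hb : ∀ ρ : ℝ, 0 < ρ → ρ < 1 → ∀ m : ℕ,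
      ‖PowerSeries.coeff m (taylor F)‖ ≤ M * (1 - ρ) ^ (1 - β) * ρ⁻¹ ^ m := by
    intro ρ h0 h1 m
    refine (norm_coeff_taylor_le hF h0 h1 m).trans ?_
    refine mul_le_mul_of_nonneg_right ?_ (by positivity)
    have hsub : Metric.sphere (0 : ℂ) |ρ| ⊆ Metric.ball 0 1 := by
      rw [abs_of_pos h0]
      exact Metric.sphere_subset_closedBall.trans (Metric.closedBall_subset_ball h1)
    have h1ρ : 0 < 1 - ρ := by linarith
    have hne : ∀ z ∈ Metric.sphere (0 : ℂ) |ρ|, 1 - ρ ≤ ‖1 - z‖ := fun z hz => by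
      have hz : ‖z‖ = ρ := by simpa [abs_of_pos h0] using hz
      have := norm_sub_norm_le (1 : ℂ) z
      rwa [norm_one, hz] at this
    -- Since β ≥ 2, the excess power |1 - z|^(2-β) is largest where |1 - z| is smallest; only |1 -
    -- z|⁻² has to be averaged.
    have hle : ∀ z ∈ Metric.sphere (0 : ℂ) |ρ|,
        ‖F z‖ ≤ (M * (1 - ρ) ^ (2 - β)) • (‖1 - z‖ ^ 2)⁻¹ := fun z hz => by
      have h2 := hne z hz
      have h3 : 0 < ‖1 - z‖ := h1ρ.trans_le h2
      calc ‖F z‖ ≤ M * ‖1 - z‖ ^ (-β) := hM z (hsub hz)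
        _ = M * (‖1 - z‖ ^ (2 - β) * (‖1 - z‖ ^ 2)⁻¹) := by
            rw [← Real.rpow_natCast, ← Real.rpow_neg h3.le, ← Real.rpow_add h3]
            congr 2; push_cast; ring
        _ ≤ M * ((1 - ρ) ^ (2 - β) * (‖1 - z‖ ^ 2)⁻¹) := by
            refine mul_le_mul_of_nonneg_left (mul_le_mul_of_nonneg_right ?_ (by positivity)) hM0
            exact Real.rpow_le_rpow_of_nonpos h1ρ h2 (by linarith)
        _ = _ := by rw [smul_eq_mul]; ring
    have hcI : CircleIntegrable (fun z : ℂ => (‖1 - z‖ ^ 2)⁻¹) 0 ρ := by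
      refine ContinuousOn.circleIntegrable' (ContinuousOn.inv₀ (by fun_prop) fun z hz => ?_)
      have := h1ρ.trans_le (hne z hz)
      positivity
    have hcF : CircleIntegrable (fun z : ℂ => ‖F z‖) 0 ρ :=
      ContinuousOn.circleIntegrable' (hF.continuousOn.mono hsub).norm
    refine (Real.circleAverage_mono hcF (hcI.const_smul (a := M * (1 - ρ) ^ (2 - β))) hle).trans ?_
    change Real.circleAverage ((M * (1 - ρ) ^ (2 - β)) • fun z : ℂ => (‖1 - z‖ ^ 2)⁻¹) 0 ρ ≤ _
    rw [Real.circleAverage_smul, circleAverage_norm_one_sub_inv_sq h0 h1, smul_eq_mul,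
      show 1 - β = 2 - β - 1 by ring, Real.rpow_sub_one h1ρ.ne', mul_assoc]
    have h4 : (1 - ρ ^ 2)⁻¹ ≤ (1 - ρ)⁻¹ := inv_anti₀ h1ρ (by nlinarith)
    rw [div_eq_mul_inv]
    gcongr
  refine IsBigO.trans (IsBigO.of_bound (M * Real.exp 1) ?_) (isBigO_add_one_rpow (β - 1))
  filter_upwards [eventually_gt_atTop 0] with m hm
  have hm' : (0 : ℝ) < m := by exact_mod_cast hm
  -- With ρ = m/(m + 1), 1 - ρ is 1/(m + 1) and ρ^(-m) = (1 + 1/m)^m stays below e.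
  have h := hb (m / (m + 1)) (by positivity) (by rw [div_lt_one (by positivity)]; linarith) m
  have e1 : 1 - (m : ℝ) / (m + 1) = ((m : ℝ) + 1)⁻¹ := by field_simp; ring
  have e2 : ((m : ℝ) / (m + 1))⁻¹ ^ m ≤ Real.exp 1 := by
    have : ((m : ℝ) / (m + 1))⁻¹ = 1 / m + 1 := by field_simp; ring
    rw [this]
    calc (1 / (m : ℝ) + 1) ^ m ≤ Real.exp (1 / m) ^ m :=
          pow_le_pow_left₀ (by positivity) (Real.add_one_le_exp _) m
      _ = Real.exp 1 := by
          rw [← Real.exp_nat_mul]; congr 1; field_simp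
  rw [e1, Real.inv_rpow (by positivity), ← Real.rpow_neg (by positivity),
    show -(1 - β) = β - 1 by ring] at h
  rw [Real.norm_of_nonneg (by positivity)]
  calc _ ≤ M * ((m : ℝ) + 1) ^ (β - 1) * Real.exp 1 := h.trans (by gcongr)
    _ = _ := by ring

/-! ### Transfer on a slit-type domain -/

/-- The slit-type domain `{‖z‖ < R, Re (z - 1) < κ ‖z - 1‖}`. -/
def slitDomain (R κ : ℝ) : Set ℂ := {z : ℂ | ‖z‖ < R ∧ (z - 1).re < κ * ‖z - 1‖}

lemma isOpen_slitDomain (R κ : ℝ) : IsOpen (slitDomain R κ) :=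
  (isOpen_lt (f := fun z : ℂ => ‖z‖) (g := fun _ => R) (by fun_prop) (by fun_prop)).inter
    (isOpen_lt (f := fun z : ℂ => (z - 1).re) (g := fun z => κ * ‖z - 1‖)
      (by fun_prop) (by fun_prop))

lemma ball_subset_slitDomain {R κ : ℝ} (hR : 1 < R) (hκ : 0 < κ) :
    Metric.ball (0 : ℂ) 1 ⊆ slitDomain R κ := by
  intro z hz
  have hz : ‖z‖ < 1 := by simpa using hz
  refine ⟨hz.trans hR, ?_⟩
  have h1 : (z - 1).re < 0 := by
    have := (Complex.re_le_norm z).trans_lt hz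
    simp; linarith
  have : 0 ≤ κ * ‖z - 1‖ := by positivity
  linarith

/-- Near 1 the bound is the hypothesis. Away from 1 the closed subdomain is compact inside the
domain, so the quotient is bounded there. -/
lemma exists_norm_le_on_subdomain {f : ℂ → ℂ} {R R' κ κ' α : ℝ} (hR : R' < R) (hκ : κ' < κ)
    (hf : DifferentiableOn ℂ f (slitDomain R κ))
    (hO : f =O[𝓝[slitDomain R κ] 1] fun z => ‖z - 1‖ ^ α) :
    ∃ M, 0 ≤ M ∧ ∀ z : ℂ, z ≠ 1 → ‖z‖ ≤ R' → (z - 1).re ≤ κ' * ‖z - 1‖ →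
      z ∈ slitDomain R κ ∧ ‖f z‖ ≤ M * ‖z - 1‖ ^ α := by
  have hmem : ∀ z : ℂ, z ≠ 1 → ‖z‖ ≤ R' → (z - 1).re ≤ κ' * ‖z - 1‖ → z ∈ slitDomain R κ := by
    intro z h1 h2 h3
    refine ⟨h2.trans_lt hR, h3.trans_lt ?_⟩
    have : 0 < ‖z - 1‖ := norm_pos_iff.2 (sub_ne_zero.2 h1)
    gcongr
  obtain ⟨C, hC⟩ := hO.bound
  rw [eventually_nhdsWithin_iff, Metric.eventually_nhds_iff] at hC
  obtain ⟨ε, hε, hC⟩ := hC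
  set K : Set ℂ := Metric.closedBall 0 R' ∩
    ({z | (z - 1).re ≤ κ' * ‖z - 1‖} ∩ {z | ε ≤ ‖z - 1‖}) with hK
  have hKc : IsCompact K := (isCompact_closedBall _ _).inter_right
    ((isClosed_le (by fun_prop) (by fun_prop)).inter (isClosed_le (by fun_prop) (by fun_prop)))
  have hKpos : ∀ z ∈ K, 0 < ‖z - 1‖ := fun z hz => hε.trans_le hz.2.2
  have hcont : ContinuousOn (fun z => ‖f z‖ / ‖z - 1‖ ^ α) K := by
    refine ContinuousOn.div (hf.continuousOn.mono fun z hz => ?_).norm ?_ fun z hz => ?_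
    · refine hmem z ?_ (by simpa using hz.1) hz.2.1
      rintro rfl
      simpa using hKpos 1 hz
    · exact ContinuousOn.rpow_const (by fun_prop) fun z hz => Or.inl (hKpos z hz).ne'
    · exact (Real.rpow_pos_of_pos (hKpos z hz) _).ne'
  obtain ⟨B, hB⟩ := (hKc.bddAbove_image hcont)
  refine ⟨max (max C B) 0, le_max_right _ _, fun z h1 h2 h3 => ⟨hmem z h1 h2 h3, ?_⟩⟩
  have hpos : 0 < ‖z - 1‖ := norm_pos_iff.2 (sub_ne_zero.2 h1)
  have hpow : 0 < ‖z - 1‖ ^ α := Real.rpow_pos_of_pos hpos _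
  by_cases hz : ‖z - 1‖ < ε
  · have := hC (by rwa [dist_eq_norm]) (hmem z h1 h2 h3)
    rw [Real.norm_of_nonneg hpow.le] at this
    refine this.trans ?_
    gcongr
    exact (le_max_left _ _).trans (le_max_left _ _)
  · have hzK : z ∈ K := ⟨by simpa using h2, h3, not_lt.1 hz⟩
    have := hB (Set.mem_image_of_mem _ hzK)
    rw [div_le_iff₀ hpow] at this
    refine this.trans ?_
    gcongr
    exact (le_max_right _ _).trans (le_max_left _ _)

/-- **Transfer**: a function on a slit-type domain which is `O(|z - 1| ^ (1 - θ))` at `1` has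
coefficients `O(n ^ (θ - 2))`. -/
lemma coeff_taylor_isBigO_of_slitDomain {f : ℂ → ℂ} {R κ θ : ℝ} (hθ : 0 < θ) (hR : 1 < R)
    (hκ : 0 < κ) (hκ1 : κ ≤ 1) (hf : DifferentiableOn ℂ f (slitDomain R κ))
    (hO : f =O[𝓝[slitDomain R κ] 1] fun z => ‖z - 1‖ ^ (1 - θ)) :
    (fun n : ℕ => PowerSeries.coeff n (taylor f)) =O[atTop] fun n : ℕ => (n : ℝ) ^ (θ - 2) := by
  set α := 1 - θ with hα
  obtain ⟨M, hM0, hM⟩ := exists_norm_le_on_subdomain (R' := (1 + R) / 2) (κ' := κ / 2)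
    (by linarith) (by linarith) hf hO
  -- The radius c |1 - t| must keep the disc around t inside the subdomain: c ≤ κ/4 ≤ 1/4 controls
  -- both the distance to 1 and the opening angle, and c ≤ (R - 1)/4 with |1 - t| ≤ 2 keeps |z| ≤ (1
  -- + R)/2.
  obtain ⟨c, hc0, hc1, hc2⟩ : ∃ c : ℝ, 0 < c ∧ c ≤ κ / 4 ∧ c ≤ (R - 1) / 4 :=
    ⟨min (κ / 4) ((R - 1) / 4), lt_min (by linarith) (by linarith), min_le_left _ _,
      min_le_right _ _⟩
  have hball : ∀ t ∈ Metric.ball (0 : ℂ) 1, ∀ z ∈ Metric.closedBall t (c * ‖1 - t‖),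
      z ∈ slitDomain R κ ∧ ‖f z‖ ≤ M * (2 ^ |α| * (5 / 4) ^ α) * ‖1 - t‖ ^ α := by
    intro t ht z hz
    have ht : ‖t‖ < 1 := by simpa using ht
    rw [Metric.mem_closedBall, dist_eq_norm] at hz
    set Y := ‖1 - t‖ with hY
    have hY0 : 0 < Y := by
      rw [hY, norm_pos_iff, sub_ne_zero]
      rintro rfl
      simp at ht
    have hY2 : Y ≤ 2 := by
      have := norm_sub_le (1 : ℂ) t
      rw [norm_one] at this; linarith
    have hcY : c * Y ≤ Y / 4 := by nlinarith
    have ht1 : ‖t - 1‖ = Y := norm_sub_rev _ _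
    have hz1 : 3 / 4 * Y ≤ ‖z - 1‖ := by
      have := norm_sub_le (z - 1) (z - t)
      rw [show z - 1 - (z - t) = t - 1 by ring, ht1] at this
      linarith
    have hz2 : ‖z - 1‖ ≤ 5 / 4 * Y := by
      have := norm_add_le (z - t) (t - 1)
      rw [show z - t + (t - 1) = z - 1 by ring, ht1] at this
      linarith
    have hne : z ≠ 1 := by
      rintro rfl
      simp at hz1; linarith
    have hzR : ‖z‖ ≤ (1 + R) / 2 := by
      have := norm_add_le (z - t) t
      rw [sub_add_cancel] at this
      nlinarith
    have hre : (z - 1).re ≤ κ / 2 * ‖z - 1‖ := by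
      have h1 : (z - 1).re = (z - t).re + (t.re - 1) := by simp
      have h2 := Complex.re_le_norm (z - t)
      have h3 := Complex.re_le_norm t
      nlinarith
    obtain ⟨hzD, hzM⟩ := hM z hne hzR hre
    refine ⟨hzD, hzM.trans ?_⟩
    have := rpow_le_of_half_le (x := ‖z - 1‖) (y := 5 / 4 * Y) α (by positivity) (by linarith) hz2
    calc M * ‖z - 1‖ ^ α ≤ M * (2 ^ |α| * (5 / 4 * Y) ^ α) := by gcongr
      _ = _ := by rw [Real.mul_rpow (by norm_num) hY0.le]; ring
  set M' := M * (2 ^ |α| * (5 / 4) ^ α) with hM'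
  have hfan : AnalyticOnNhd ℂ f (slitDomain R κ) :=
    hf.analyticOnNhd (isOpen_slitDomain R κ)
  -- Each derivative costs one power of |1 - t|. Three of them give the exponent -(2 + θ), which is
  -- at most -2 for every θ > 0, as the growth lemma requires; the coefficient relation then returns
  -- the factor m^(-3).
  have hd3 : DifferentiableOn ℂ (iteratedDeriv 3 f) (Metric.ball 0 1) := fun t ht => by
    rw [iteratedDeriv_eq_iterate]
    exact (AnalyticAt.iterated_deriv (hfan t (ball_subset_slitDomain hR hκ ht))
      3).differentiableAt.differentiableWithinAt
  have hgrow : ∀ t ∈ Metric.ball (0 : ℂ) 1,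
      ‖iteratedDeriv 3 f t‖ ≤ (6 * M' / c ^ 3) * ‖1 - t‖ ^ (-(2 + θ)) := by
    intro t ht
    have hY0 : 0 < ‖1 - t‖ := by
      rw [norm_pos_iff, sub_ne_zero]
      rintro rfl
      simp at ht
    have hρ : 0 < c * ‖1 - t‖ := by positivity
    have hdc : DiffContOnCl ℂ f (Metric.ball t (c * ‖1 - t‖)) := by
      refine DifferentiableOn.diffContOnCl (hf.mono fun z hz => ?_)
      exact (hball t ht z (Metric.closure_ball_subset_closedBall hz)).1
    have := Complex.norm_iteratedDeriv_le_of_forall_mem_sphere_norm_le 3 hρ hdc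
      (fun z hz => (hball t ht z (Metric.sphere_subset_closedBall hz)).2)
    refine this.trans (le_of_eq ?_)
    have e : ‖1 - t‖ ^ (-(2 + θ)) = ‖1 - t‖ ^ α / ‖1 - t‖ ^ 3 := by
      rw [← Real.rpow_natCast, ← Real.rpow_sub hY0, hα]; congr 1; push_cast; ring
    rw [e, mul_pow]
    simp only [Nat.factorial]
    push_cast
    field_simp
  have h3 := coeff_taylor_isBigO_of_growth hd3 (β := 2 + θ) (by linarith) hgrow
  have hcoef (m : ℕ) : PowerSeries.coeff (m + 3) (taylor f) =
      PowerSeries.coeff m (taylor (iteratedDeriv 3 f)) / ((m + 1) * (m + 2) * (m + 3)) := by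
    have e : iteratedDeriv 3 f = deriv (deriv (deriv f)) := by
      rw [iteratedDeriv_eq_iterate]; rfl
    rw [e, coeff_taylor_deriv, coeff_taylor_deriv, coeff_taylor_deriv]
    have h1 : (m + 1 : ℂ) ≠ 0 := by exact_mod_cast (m.succ_ne_zero)
    have h2 : (m + 2 : ℂ) ≠ 0 := by exact_mod_cast ((m + 1).succ_ne_zero)
    have h4 : (m + 3 : ℂ) ≠ 0 := by exact_mod_cast ((m + 2).succ_ne_zero)
    push_cast
    rw [show (m : ℂ) + 1 + 1 = m + 2 by ring, show (m : ℂ) + 2 + 1 = m + 3 by ring]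
    field_simp
  have h4 : (fun m : ℕ => PowerSeries.coeff (m + 3) (taylor f)) =O[atTop]
      fun m : ℕ => (m : ℝ) ^ (θ - 2) := by
    have hq : (fun m : ℕ => (((m : ℂ) + 1) * (m + 2) * (m + 3))⁻¹) =O[atTop]
        fun m : ℕ => (m : ℝ) ^ (-3 : ℝ) := by
      refine IsBigO.of_bound 1 ?_
      filter_upwards [eventually_gt_atTop 0] with m hm
      have hm' : (0 : ℝ) < m := by exact_mod_cast hm
      have : (((m : ℂ) + 1) * (m + 2) * (m + 3)) = (((m : ℝ) + 1) * (m + 2) * (m + 3) : ℝ) := by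
        push_cast; ring
      rw [this, norm_inv, Complex.norm_real, Real.norm_of_nonneg (by positivity), one_mul,
        Real.norm_of_nonneg (by positivity), Real.rpow_neg hm'.le]
      refine inv_anti₀ (by positivity) ?_
      rw [show (3 : ℝ) = (3 : ℕ) by norm_num, Real.rpow_natCast]
      push_cast
      nlinarith [pow_pos hm' 2, pow_pos hm' 3]
    refine (h3.mul hq).congr' ?_ ?_
    · exact Eventually.of_forall fun m => by simp only [hcoef, div_eq_mul_inv]
    · filter_upwards [eventually_gt_atTop 0] with m hm
      have hm' : (0 : ℝ) < m := by exact_mod_cast hm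
      rw [← Real.rpow_add hm']; congr 1; ring
  have h5 := h4.comp_tendsto (tendsto_sub_atTop_nat 3)
  have h6 : (fun n : ℕ => ((n - 3 : ℕ) : ℝ) ^ (θ - 2)) =O[atTop]
      fun n : ℕ => (n : ℝ) ^ (θ - 2) := by
    refine IsBigO.of_bound (2 ^ |θ - 2|) ?_
    filter_upwards [eventually_ge_atTop 6] with n hn
    have hn' : (6 : ℝ) ≤ n := by exact_mod_cast hn
    rw [Real.norm_of_nonneg (by positivity), Real.norm_of_nonneg (by positivity)]
    refine rpow_le_of_half_le _ (by linarith) ?_ ?_ <;> rw [Nat.cast_sub (by omega)] <;>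
      push_cast <;> linarith
  refine (h5.trans h6).congr' ?_ EventuallyEq.rfl
  filter_upwards [eventually_ge_atTop 3] with n hn
  simp only [Function.comp_apply]
  rw [Nat.sub_add_cancel hn]

/-! ### Coefficient asymptotics for the class `F` -/

/-- Since Re(z - 1) = |z - 1| cos(arg(z - 1)) and cos decreases on [0, π], the bound with cos φ
forces |arg(z - 1)| > φ. -/
lemma slitDomain_subset_Delta0 {R φ : ℝ} (hφ0 : 0 < φ) (hφ : φ < Real.pi / 2) :
    slitDomain R (Real.cos φ) ⊆ Delta0 1 R φ := by
  rintro z ⟨hzR, hz⟩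
  have hne : z ≠ 1 := by rintro rfl; simp at hz
  have hpos : 0 < ‖z - 1‖ := norm_pos_iff.2 (sub_ne_zero.2 hne)
  refine ⟨hzR, by simpa using hne, ?_⟩
  rw [Complex.ofReal_one]
  by_contra! h
  have h1 := Real.cos_le_cos_of_nonneg_of_le_pi (abs_nonneg _) (by linarith [Real.pi_pos]) h
  rw [Real.cos_abs] at h1
  have h2 := Complex.norm_mul_cos_arg (z - 1)
  nlinarith

/-- On the excluded ray [1, ∞) one has Re(z - 1) = |z - 1|, against the strict inequality with κ ≤
1. -/
lemma one_sub_mem_slitPlane {R κ : ℝ} (hκ : κ ≤ 1) {z : ℂ} (hz : z ∈ slitDomain R κ) :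
    1 - z ∈ Complex.slitPlane := by
  rw [Complex.mem_slitPlane_iff]
  by_contra! h
  obtain ⟨h1, h2⟩ := h
  have hre : z - 1 = ((z - 1).re : ℂ) := by
    apply Complex.ext
    · simp
    · simp at h2 ⊢; linarith
  have hn : ‖z - 1‖ = (z - 1).re := by
    conv_lhs => rw [hre]
    rw [Complex.norm_real, Real.norm_of_nonneg]
    simp at h1 ⊢; linarith
  have := hz.2
  rw [hn] at this
  have h0 : 0 ≤ (z - 1).re := hn ▸ norm_nonneg _
  nlinarith

/-- A version of the class `F(r, θ)` which records the constant `K`. -/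
def ClassFWith (r θ : ℝ) (K : ℂ) (g : ℂ → ℂ) : Prop :=
  ∃ R φ : ℝ, r < R ∧ 0 < φ ∧ φ < Real.pi / 2 ∧
    DifferentiableOn ℂ g (Delta0 r R φ) ∧
      (fun t : ℂ => g t - ((θ : ℂ) * Complex.log (1 / (1 - t / (r : ℂ))) + K))
        =O[𝓝[Delta0 r R φ] (r : ℂ)] fun t : ℂ => t - (r : ℂ)

lemma ClassF.exists_classFWith {r θ : ℝ} {g : ℂ → ℂ} (h : ClassF r θ g) :
    ∃ K, ClassFWith r θ K g := by
  obtain ⟨R, φ, h1, h2, h3, h4, K, h5⟩ := h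
  exact ⟨K, R, φ, h1, h2, h3, h4, h5⟩

/-- Scaling by r > 0 preserves arguments, so φ is unchanged and R becomes R/r. -/
lemma ClassFWith.comp_mul {r θ : ℝ} {K : ℂ} {g : ℂ → ℂ} (hr : 0 < r) (h : ClassFWith r θ K g) :
    ClassFWith 1 θ K fun z => g (r * z) := by
  obtain ⟨R, φ, h1, h2, h3, h4, h5⟩ := h
  have hrc : (r : ℂ) ≠ 0 := by exact_mod_cast hr.ne'
  have hmaps : Set.MapsTo (fun z : ℂ => r * z) (Delta0 1 (R / r) φ) (Delta0 r R φ) := by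
    rintro z ⟨hz1, hz2, hz3⟩
    refine ⟨?_, ?_, ?_⟩
    · rw [norm_mul, Complex.norm_real, Real.norm_of_nonneg hr.le]
      rwa [lt_div_iff₀' hr] at hz1
    · intro h
      exact hz2 (by simpa using mul_left_cancel₀ hrc (h.trans (mul_one _).symm))
    · have : (r : ℂ) * z - r = r * (z - (1 : ℝ)) := by push_cast; ring
      rwa [this, Complex.arg_real_mul _ hr]
  refine ⟨R / r, φ, by rwa [lt_div_iff₀ hr, one_mul], h2, h3,
    h4.comp (by fun_prop) hmaps, ?_⟩
  have ht : Tendsto (fun z : ℂ => r * z) (𝓝[Delta0 1 (R / r) φ] ((1 : ℝ) : ℂ))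
      (𝓝[Delta0 r R φ] (r : ℂ)) := by
    refine tendsto_nhdsWithin_of_tendsto_nhds_of_eventually_within _ ?_ ?_
    · have : ContinuousAt (fun z : ℂ => r * z) ((1 : ℝ) : ℂ) := by fun_prop
      have h := this.tendsto
      simp only [Complex.ofReal_one, mul_one] at h
      exact (by simpa using h : Tendsto _ (𝓝 ((1 : ℝ) : ℂ)) _).mono_left nhdsWithin_le_nhds
    · filter_upwards [self_mem_nhdsWithin] with z hz using hmaps hz
  have h6 := h5.comp_tendsto ht
  have h7 : (fun z : ℂ => (r : ℂ) * z - r) =O[𝓝[Delta0 1 (R / r) φ] ((1 : ℝ) : ℂ)]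
      fun z : ℂ => z - ((1 : ℝ) : ℂ) := by
    refine IsBigO.of_bound r (Eventually.of_forall fun z => le_of_eq ?_)
    rw [show (r : ℂ) * z - r = r * (z - (1 : ℝ)) by push_cast; ring, norm_mul, Complex.norm_real,
      Real.norm_of_nonneg hr.le]
  refine (h6.trans h7).congr_left fun z => ?_
  simp only [Function.comp_apply]
  rw [mul_div_cancel_left₀ _ hrc]
  simp

/-- Only p(t) = p(r) + O(t - r) matters, so removing finitely many terms of g_Θ just shifts the
constant. -/
lemma ClassFWith.sub {r θ : ℝ} {K : ℂ} {g p : ℂ → ℂ} (hp : Differentiable ℂ p)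
    (h : ClassFWith r θ K g) : ClassFWith r θ (K - p r) fun z => g z - p z := by
  obtain ⟨R, φ, h1, h2, h3, h4, h5⟩ := h
  refine ⟨R, φ, h1, h2, h3, h4.sub hp.differentiableOn, ?_⟩
  have h6 : (fun t => p t - p r) =O[𝓝[Delta0 r R φ] (r : ℂ)] fun t : ℂ => t - (r : ℂ) :=
    (hp.differentiableAt.isBigO_sub).mono nhdsWithin_le_nhds
  refine (h5.sub h6).congr_left fun t => ?_
  ring

lemma norm_exp_mul_log {θ : ℝ} {z : ℂ} (hz : z ≠ 1) :
    ‖Complex.exp (θ * Complex.log (1 / (1 - z)))‖ = ‖z - 1‖ ^ (-θ) := by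
  have hpos : 0 < ‖z - 1‖ := norm_pos_iff.2 (sub_ne_zero.2 hz)
  rw [Complex.norm_exp, Complex.re_ofReal_mul, Complex.log_re, norm_div, norm_one,
    norm_sub_rev, one_div, Real.log_inv, Real.rpow_def_of_pos hpos]
  congr 1; ring

/-- Transfer for the class `F(1, θ)`: coefficients of `exp ∘ g`. -/
lemma ClassFWith.coeff_taylor_exp_isBigO {θ : ℝ} {K : ℂ} {g : ℂ → ℂ} (hθ : 0 < θ)
    (hg : AnalyticAt ℂ g 0) (h : ClassFWith 1 θ K g) :
    (fun n : ℕ => PowerSeries.coeff n (taylor fun z => Complex.exp (g z)) -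
        negBinomCoeff θ n * Complex.exp K) =O[atTop] fun n : ℕ => (n : ℝ) ^ (θ - 2) := by
  obtain ⟨R, φ, hR, hφ0, hφ, hd, hO⟩ := h
  set κ := Real.cos φ with hκdef
  have hκ : 0 < κ := Real.cos_pos_of_mem_Ioo ⟨by linarith, hφ⟩
  have hκ1 : κ ≤ 1 := Real.cos_le_one φ
  have hsub : slitDomain R κ ⊆ Delta0 1 R φ := slitDomain_subset_Delta0 hφ0 hφ
  set l : ℂ → ℂ := fun z => θ * Complex.log (1 / (1 - z)) with hl
  have hld : DifferentiableOn ℂ l (slitDomain R κ) := fun z hz => by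
    have h1 := one_sub_mem_slitPlane hκ1 hz
    have h2 : 1 - z ≠ 0 := Complex.slitPlane_ne_zero h1
    have h3 : 1 / (1 - z) ∈ Complex.slitPlane := by
      rw [one_div, Complex.mem_slitPlane_iff_arg, Complex.arg_inv]
      rw [Complex.mem_slitPlane_iff_arg] at h1
      refine ⟨?_, inv_ne_zero h2⟩
      rw [if_neg h1.1]
      intro h
      have := Complex.neg_pi_lt_arg (1 - z)
      linarith
    have h4 : DifferentiableAt ℂ (fun z : ℂ => 1 / (1 - z)) z :=
      DifferentiableAt.div (by fun_prop) (by fun_prop) h2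
    exact ((h4.clog h3).const_mul _).differentiableWithinAt
  set f : ℂ → ℂ := fun z => Complex.exp (g z) - Complex.exp K * Complex.exp (l z) with hf
  have hfd : DifferentiableOn ℂ f (slitDomain R κ) :=
    (hd.mono hsub).cexp.sub ((differentiableOn_const _).mul hld.cexp)
  rw [Complex.ofReal_one] at hO
  have hO' : (fun t : ℂ => g t - (l t + K)) =O[𝓝[slitDomain R κ] 1] fun t : ℂ => t - 1 := by
    refine (hO.mono (nhdsWithin_mono _ hsub)).congr_left fun t => ?_
    simp [hl]
  have ht0 : Tendsto (fun t : ℂ => t - 1) (𝓝[slitDomain R κ] 1) (𝓝 0) := by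
    have : ContinuousAt (fun t : ℂ => t - 1) 1 := by fun_prop
    have h := this.tendsto
    rw [sub_self] at h
    exact h.mono_left nhdsWithin_le_nhds
  have hu0 := hO'.trans_tendsto ht0
  have hexp : (fun t : ℂ => Complex.exp (g t - (l t + K)) - 1) =O[𝓝[slitDomain R κ] 1]
      fun t : ℂ => t - 1 := by
    have h1 : (fun w : ℂ => Complex.exp w - Complex.exp 0) =O[𝓝 0] fun w : ℂ => w - 0 :=
      (Complex.hasDerivAt_exp 0).differentiableAt.isBigO_sub
    simp only [Complex.exp_zero, sub_zero] at h1
    exact (h1.comp_tendsto hu0).trans hO'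
  have hel : (fun t : ℂ => Complex.exp K * Complex.exp (l t)) =O[𝓝[slitDomain R κ] 1]
      fun t : ℂ => ‖t - 1‖ ^ (-θ) := by
    refine IsBigO.of_bound ‖Complex.exp K‖ ?_
    filter_upwards [self_mem_nhdsWithin] with t ht
    have hne : t ≠ 1 := by rintro rfl; simpa using ht.2
    rw [norm_mul, norm_exp_mul_log hne, Real.norm_of_nonneg (by positivity)]
  -- Factor f = e^K e^l (e^(g - l - K) - 1): the first two factors have size |t - 1|^(-θ), the last
  -- is O(t - 1).
  have hfO : f =O[𝓝[slitDomain R κ] 1] fun z => ‖z - 1‖ ^ (1 - θ) := by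
    refine (hel.mul hexp.norm_right).congr' ?_ ?_
    · refine Eventually.of_forall fun t => ?_
      simp only [hf]
      rw [mul_sub, mul_one, ← Complex.exp_add, ← Complex.exp_add]
      congr 2; ring
    · filter_upwards [self_mem_nhdsWithin] with t ht
      have hne : t ≠ 1 := by rintro rfl; simpa using ht.2
      have hpos : 0 < ‖t - 1‖ := norm_pos_iff.2 (sub_ne_zero.2 hne)
      rw [← Real.rpow_add_one hpos.ne']; congr 1; ring
  have key := coeff_taylor_isBigO_of_slitDomain hθ hR hκ hκ1 hfd hfO
  refine key.congr_left fun n => ?_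
  have hlan : AnalyticAt ℂ l 0 := (isExpansionAtZero_log θ).analyticAt
  have h1 := (isExpansionAtZero_taylor hg.cexp).sub (isExpansionAtZero_taylor
    (F := fun z => Complex.exp K * Complex.exp (l z)) (analyticAt_const.mul hlan.cexp))
  have h2 := h1.eq_taylor
  have h3 : taylor f = taylor (Complex.exp ∘ g) -
      taylor fun z => Complex.exp K * Complex.exp (l z) := h2.symm
  rw [h3, map_sub, taylor_const_mul, coeff_taylor_exp_log, mul_comm]
  rfl

/-! ### Generating functions of the truncated partition sums -/

/-- The polynomial `∑_{m ≤ b} (θ_m / m) z ^ m`. -/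
def initialPoly (Θ : ℕ → ℝ) (b : ℕ) (z : ℂ) : ℂ :=
  ∑ m ∈ Finset.Icc 1 b, ((Θ m / m : ℝ) : ℂ) * z ^ m

lemma differentiable_initialPoly (Θ : ℕ → ℝ) (b : ℕ) : Differentiable ℂ (initialPoly Θ b) := by
  unfold initialPoly; fun_prop

lemma coeff_gSeries_sub (Θ : ℕ → ℝ) (b k : ℕ) :
    PowerSeries.coeff k (gSeries Θ - gSeries (truncate b Θ)) =
      if k ∈ Finset.Icc 1 b then ((Θ k / k : ℝ) : ℂ) else 0 := by
  simp only [gSeries, truncate, map_sub, PowerSeries.coeff_mk, Finset.mem_Icc]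
  split_ifs <;> first | omega | simp

lemma hasSum_initialPoly (Θ : ℕ → ℝ) (b : ℕ) (z : ℂ) :
    HasSum (fun k => PowerSeries.coeff k (gSeries Θ - gSeries (truncate b Θ)) * z ^ k)
      (initialPoly Θ b z) := by
  have : initialPoly Θ b z = ∑ k ∈ Finset.Icc 1 b,
      PowerSeries.coeff k (gSeries Θ - gSeries (truncate b Θ)) * z ^ k :=
    Finset.sum_congr rfl fun k hk => by rw [coeff_gSeries_sub, if_pos hk]
  rw [this]
  refine hasSum_sum_of_ne_finset_zero fun k hk => ?_
  rw [coeff_gSeries_sub, if_neg hk, zero_mul]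

lemma isExpansionAtZero_initialPoly (Θ : ℕ → ℝ) (b : ℕ) :
    IsExpansionAtZero (gSeries Θ - gSeries (truncate b Θ)) (initialPoly Θ b) :=
  Eventually.of_forall fun z => hasSum_initialPoly Θ b z

lemma isExpansionAtZero_truncate {Θ : ℕ → ℝ} {g : ℂ → ℂ} (h : IsExpansionAtZero (gSeries Θ) g)
    (b : ℕ) : IsExpansionAtZero (gSeries (truncate b Θ)) fun z => g z - initialPoly Θ b z := by
  have := h.sub (isExpansionAtZero_initialPoly Θ b)
  rwa [sub_sub_cancel] at this

/-- The partition sums are the coefficients of `exp ∘ g`. -/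
lemma coeff_taylor_exp_gSeries {Θ : ℕ → ℝ} {g : ℂ → ℂ} (h : IsExpansionAtZero (gSeries Θ) g)
    (r : ℂ) (n : ℕ) :
    PowerSeries.coeff n (taylor fun z => Complex.exp (g (r * z))) =
      r ^ n * (partitionSum Θ n : ℂ) := by
  have hE : AnalyticAt ℂ (fun z => Complex.exp (g z)) 0 := h.analyticAt.cexp
  rw [← ((isExpansionAtZero_taylor hE).comp_mul r).eq_taylor, PowerSeries.coeff_rescale]
  congr 1
  -- The recursion `mul_partitionSum` is the one for exp ∘ g because m [t^m] g = θ_m; the rewriting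
  -- of `h1` only shifts the summation index by one.
  refine coeff_taylor_exp_eq h.analyticAt (fun n => (partitionSum Θ n : ℂ)) ?_ (fun n => ?_) n
  · rw [partitionSum_zero, ← coeff_zero_taylor g, ← h.eq_taylor]
    simp [gSeries]
  · have h1 := mul_partitionSum Θ (n + 1)
    rw [← Finset.sum_image (s := Finset.range (n + 1)) (g := fun k => k + 1)
      (f := fun m => Θ m * partitionSum Θ (n + 1 - m)) (by simp) |>.symm.trans (Finset.sum_congr
        (by ext m; simp only [Finset.mem_image, Finset.mem_range, Finset.mem_Icc]
            exact ⟨fun ⟨a, ha, hb⟩ => by omega, fun hm => ⟨m - 1, by omega, by omega⟩⟩)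
        fun _ _ => rfl)] at h1
    rw [← h.eq_taylor]
    have h2 : ((n : ℂ) + 1) * (partitionSum Θ (n + 1) : ℂ) =
        ∑ k ∈ Finset.range (n + 1), (Θ (k + 1) : ℂ) * (partitionSum Θ (n - k) : ℂ) := by
      simp only [Nat.add_sub_add_right] at h1
      exact_mod_cast h1
    rw [h2]
    refine Finset.sum_congr rfl fun k _ => ?_
    have : (k + 1 : ℂ) ≠ 0 := by exact_mod_cast k.succ_ne_zero
    simp only [gSeries, PowerSeries.coeff_mk, Nat.succ_ne_zero, if_false]
    push_cast
    field_simp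

/-- The constant L is chosen before b: it has to cancel between the truncated numerator and the full
denominator. -/
lemma SeriesClassF.exists_isBigO {Θ : ℕ → ℝ} {r θ : ℝ} (hr : 0 < r) (hθ : 0 < θ)
    (h : SeriesClassF r θ (gSeries Θ)) :
    ∃ L : ℂ, ∀ b : ℕ, (fun n : ℕ => (r : ℂ) ^ n * (partitionSum (truncate b Θ) n : ℂ) -
        negBinomCoeff θ n * Complex.exp (L - initialPoly Θ b r))
      =O[atTop] fun n : ℕ => (n : ℝ) ^ (θ - 1) * (1 / (n : ℝ)) := by
  obtain ⟨g, hg, hF⟩ := h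
  obtain ⟨K, hK⟩ := hF.exists_classFWith
  refine ⟨K, fun b => ?_⟩
  have hgb := isExpansionAtZero_truncate hg b
  have h1 := (hK.sub (differentiable_initialPoly Θ b)).comp_mul hr
  have h2 := h1.coeff_taylor_exp_isBigO hθ (hgb.comp_mul (r : ℂ)).analyticAt
  refine h2.congr' ?_ ?_
  · refine Eventually.of_forall fun n => ?_
    change PowerSeries.coeff n (taylor fun z =>
      Complex.exp ((fun w => g w - initialPoly Θ b w) (r * z))) - _ = _
    rw [coeff_taylor_exp_gSeries hgb]
  · filter_upwards [eventually_gt_atTop 0] with n hn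
    have hn' : (n : ℝ) ≠ 0 := by exact_mod_cast hn.ne'
    rw [mul_one_div, ← Real.rpow_sub_one hn']; congr 1; ring

lemma SeriesClassEF.exists_isBigO {Θ : ℕ → ℝ} {r θ γ : ℝ} (hr : 0 < r) (hθ : 0 < θ) (hγ : 0 < γ)
    (hγ1 : γ ≤ 1) (h : SeriesClassEF r θ γ (gSeries Θ)) :
    ∃ L : ℂ, ∀ b : ℕ, (fun n : ℕ => (r : ℂ) ^ n * (partitionSum (truncate b Θ) n : ℂ) -
        negBinomCoeff θ n * Complex.exp (L - initialPoly Θ b r))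
      =O[atTop] fun n : ℕ => (n : ℝ) ^ (θ - 1) * (Real.log n / (n : ℝ) ^ γ) := by
  obtain ⟨g, hg, g₀, hg₀d, hg₀, a, ha, haO⟩ := h
  have hrc : (r : ℂ) ≠ 0 := by exact_mod_cast hr.ne'
  have hmaps : Set.MapsTo (fun z : ℂ => r * z) (Metric.ball 0 1) (Metric.ball 0 r) := fun z hz => by
    rw [mem_ball_zero_iff] at hz ⊢
    rw [norm_mul, Complex.norm_real, Real.norm_of_nonneg hr.le]
    nlinarith
  have hdecay : ∀ {f : PowerSeries ℂ}, ((fun n : ℕ => PowerSeries.coeff n f) =O[atTop]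
      fun n : ℕ => (n : ℝ) ^ (-1 - γ)) → HasDecay γ f := fun {f} hf => by
    obtain ⟨C, h0, hC⟩ := exists_forall_norm_le_of_isBigO hf
    exact ⟨C, h0.le, hC⟩
  have haO' : (fun n : ℕ => PowerSeries.coeff n (PowerSeries.rescale (r : ℂ) a)) =O[atTop]
      fun n : ℕ => (n : ℝ) ^ (-1 - γ) := by
    have h1 : (fun n : ℕ => (r : ℂ) ^ n) =O[atTop] fun n : ℕ => r ^ n :=
      IsBigO.of_bound 1 (Eventually.of_forall fun n => by simp)
    refine (h1.mul haO).congr (fun n => ?_) fun n => ?_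
    · rw [PowerSeries.coeff_rescale]
    · rw [← mul_assoc, mul_inv_cancel₀ (pow_ne_zero _ hr.ne'), one_mul]
  have hsa := (hdecay haO').summable hγ
  refine ⟨∑' n, PowerSeries.coeff n (PowerSeries.rescale (r : ℂ) a), fun b => ?_⟩
  have hgb := isExpansionAtZero_truncate hg b
  set q := gSeries Θ - gSeries (truncate b Θ) with hq
  have hexp := (ha.sub (isExpansionAtZero_initialPoly Θ b)).comp_mul (r : ℂ)
  have hd0 : DifferentiableOn ℂ (fun z : ℂ => g₀ (r * z) - initialPoly Θ b (r * z))
      (Metric.ball 0 1) :=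
    (hg₀d.comp (by fun_prop) hmaps).sub
      ((differentiable_initialPoly Θ b).comp (by fun_prop)).differentiableOn
  have htay : taylor (fun z : ℂ => g₀ (r * z) - initialPoly Θ b (r * z)) =
      PowerSeries.rescale (r : ℂ) a - PowerSeries.rescale (r : ℂ) q := by
    rw [← map_sub]; exact hexp.eq_taylor.symm
  have hqO : (fun n : ℕ => PowerSeries.coeff n (PowerSeries.rescale (r : ℂ) q)) =O[atTop]
      fun n : ℕ => (n : ℝ) ^ (-1 - γ) := by
    -- The subtracted series is a polynomial, so its coefficients beyond b vanish and cannot spoil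
    -- the decay.
    refine IsBigO.of_bound 0 ?_
    filter_upwards [eventually_gt_atTop b] with n hn
    rw [PowerSeries.coeff_rescale, hq, coeff_gSeries_sub, if_neg (by simp; omega)]
    simp
  have hdec : HasDecay γ (taylor fun z : ℂ => g₀ (r * z) - initialPoly Θ b (r * z)) := by
    rw [htay]
    exact hdecay ((haO'.sub hqO).congr_left fun n =>
      (map_sub (PowerSeries.coeff n) _ _).symm)
  have hsum : ∑' n, PowerSeries.coeff n
      (taylor fun z : ℂ => g₀ (r * z) - initialPoly Θ b (r * z)) =
      ∑' n, PowerSeries.coeff n (PowerSeries.rescale (r : ℂ) a) - initialPoly Θ b r := by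
    have h1 : HasSum (fun n => PowerSeries.coeff n (PowerSeries.rescale (r : ℂ) q))
        (initialPoly Θ b r) := by
      simpa only [PowerSeries.coeff_rescale, mul_comm] using hasSum_initialPoly Θ b r
    rw [← (hsa.hasSum.sub h1).tsum_eq, htay]
    exact tsum_congr fun n => map_sub _ _ _
  have h2 := coeff_taylor_exp_isBigO_log hθ hγ hγ1 hd0 hdec
  rw [hsum] at h2
  refine h2.congr_left fun n => ?_
  rw [← coeff_taylor_exp_gSeries hgb]
  congr 2
  -- The formula with g₀ is known only on the disc |z| < 1, but equality of germs at 0 determines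
  -- the Taylor series.
  have hE : AnalyticAt ℂ (fun z => Complex.exp ((fun w => g w - initialPoly Θ b w) (r * z))) 0 :=
    (hgb.comp_mul (r : ℂ)).analyticAt.cexp
  refine (((isExpansionAtZero_taylor hE).congr ?_).eq_taylor).symm
  filter_upwards [Metric.ball_mem_nhds (0 : ℂ) one_pos] with z hz
  rw [hg₀ _ (hmaps hz), mul_div_cancel_left₀ _ hrc, add_sub_assoc]

/-! ### Ratios of partition sums and admissible error rates -/

/-- The asymptotic expansion, with relative error `ε`, of all truncated partition sums. -/
def HasExpAsymptotics (Θ : ℕ → ℝ) (r θ : ℝ) (ε : ℕ → ℝ) : Prop :=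
  ∃ L : ℂ, ∀ b : ℕ, (fun n : ℕ => (r : ℂ) ^ n * (partitionSum (truncate b Θ) n : ℂ) -
      negBinomCoeff θ n * Complex.exp (L - initialPoly Θ b r))
    =O[atTop] fun n : ℕ => (n : ℝ) ^ (θ - 1) * ε n

/-- The conditions on the relative error. -/
structure IsErrorRate (ε : ℕ → ℝ) : Prop where
  tendsto_zero : Tendsto ε atTop (𝓝 0)
  one_div_isBigO : (fun n : ℕ => 1 / (n : ℝ)) =O[atTop] ε
  shift_isBigO : ∀ s : ℕ, (fun n : ℕ => ε (n - s)) =O[atTop] ε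

lemma partitionSum_truncate_zero (Θ : ℕ → ℝ) (n : ℕ) :
    partitionSum (truncate 0 Θ) n = partitionSum Θ n :=
  Finset.sum_congr rfl fun p _ => multisetWeight_congr fun m hm => by
    have := p.parts_pos hm
    simp [truncate, this.ne']

lemma multisetWeight_nonneg {Θ : ℕ → ℝ} (hΘ : ∀ m : ℕ, 1 ≤ m → 0 ≤ Θ m) (M : Multiset ℕ)
    (hM : ∀ m ∈ M, 0 < m) : 0 ≤ multisetWeight Θ M :=
  Finset.prod_nonneg fun m hm => by
    have := hΘ m (hM m (Multiset.mem_toFinset.1 hm))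
    positivity

lemma partitionSum_nonneg {Θ : ℕ → ℝ} (hΘ : ∀ m : ℕ, 1 ≤ m → 0 ≤ Θ m) (n : ℕ) :
    0 ≤ partitionSum Θ n :=
  Finset.sum_nonneg fun p _ => multisetWeight_nonneg hΘ _ fun _ hm => p.parts_pos hm

lemma isBigO_shift_rpow (s : ℕ) (α : ℝ) :
    (fun n : ℕ => ((n - s : ℕ) : ℝ) ^ α) =O[atTop] fun n : ℕ => (n : ℝ) ^ α := by
  refine IsBigO.of_bound (2 ^ |α|) ?_
  filter_upwards [eventually_ge_atTop (2 * s + 1)] with n hn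
  have hn' : (2 : ℝ) * s + 1 ≤ n := by exact_mod_cast hn
  have hs : (0 : ℝ) ≤ s := Nat.cast_nonneg s
  rw [Real.norm_of_nonneg (by positivity), Real.norm_of_nonneg (by positivity)]
  refine rpow_le_of_half_le _ (by linarith) ?_ ?_ <;> rw [Nat.cast_sub (by omega)] <;> linarith

section Ratio

variable {Θ : ℕ → ℝ} {r θ : ℝ} {ε : ℕ → ℝ}

/-- The main term a_n e^L has exact order n^(θ-1) because e^L ≠ 0, and the error is of smaller
order; truncation at 0 changes nothing. -/
lemma isBigO_rpow_mul_partitionSum (hθ : 0 < θ) (hε : IsErrorRate ε)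
    (h : HasExpAsymptotics Θ r θ ε) :
    (fun n : ℕ => (n : ℝ) ^ (θ - 1)) =O[atTop]
      fun n : ℕ => (r : ℂ) ^ n * (partitionSum Θ n : ℂ) := by
  obtain ⟨L, hL⟩ := h
  have h0 := hL 0
  simp only [partitionSum_truncate_zero, initialPoly, zero_lt_one, Finset.Icc_eq_empty_of_lt,
    Finset.sum_empty, sub_zero] at h0
  have ha : (fun n : ℕ => (n : ℝ) ^ (θ - 1)) =O[atTop]
      fun n : ℕ => (negBinomCoeff θ n : ℂ) * Complex.exp L := by
    refine (isBigO_negBinomCoeff hθ).trans (IsBigO.of_bound ‖Complex.exp L‖⁻¹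
      (Eventually.of_forall fun n => le_of_eq ?_))
    rw [norm_mul, Complex.norm_real]
    have : ‖Complex.exp L‖ ≠ 0 := norm_ne_zero_iff.2 (Complex.exp_ne_zero L)
    field_simp
  have hlo : (fun n : ℕ => (n : ℝ) ^ (θ - 1) * ε n) =o[atTop]
      fun n : ℕ => (n : ℝ) ^ (θ - 1) := by
    have h1 : ε =o[atTop] fun _ => (1 : ℝ) := (isLittleO_one_iff ℝ).2 hε.tendsto_zero
    simpa using (isBigO_refl (fun n : ℕ => (n : ℝ) ^ (θ - 1)) atTop).mul_isLittleO h1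
  have h1 := (h0.trans_isLittleO hlo).trans_isBigO ha
  have h2 := ha.trans h1.right_isBigO_add
  simpa using h2

/-- The lower bound excludes the value 0, and the sum is nonnegative. -/
lemma eventually_partitionSum_pos (hΘ : ∀ m : ℕ, 1 ≤ m → 0 ≤ Θ m) (hθ : 0 < θ)
    (hε : IsErrorRate ε) (h : HasExpAsymptotics Θ r θ ε) :
    ∀ᶠ n in atTop, 0 < partitionSum Θ n := by
  obtain ⟨C, hC⟩ := (isBigO_rpow_mul_partitionSum hθ hε h).bound
  filter_upwards [hC, eventually_gt_atTop 0] with n hn hn0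
  refine lt_of_le_of_ne (partitionSum_nonneg hΘ n) fun h0 => ?_
  rw [← h0] at hn
  have : 0 < (n : ℝ) ^ (θ - 1) := Real.rpow_pos_of_pos (by exact_mod_cast hn0) _
  rw [Real.norm_of_nonneg this.le] at hn
  simp at hn
  linarith

/-- Three errors meet: the expansion at n - s, the replacement of a_(n-s) by a_n, and the expansion
of the denominator. All are O(n^(θ-1) ε(n)), and the denominator has at least order n^(θ-1). -/
lemma partitionSum_ratio_isBigO (hr : 0 < r) (hΘ : ∀ m : ℕ, 1 ≤ m → 0 ≤ Θ m) (hθ : 0 < θ)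
    (hε : IsErrorRate ε) (h : HasExpAsymptotics Θ r θ ε) (b s : ℕ) :
    (fun n : ℕ => partitionSum (truncate b Θ) (n - s) / partitionSum Θ n -
        r ^ s * Real.exp (-∑ m ∈ Finset.Icc 1 b, Θ m / m * r ^ m)) =O[atTop] ε := by
  have hu := isBigO_rpow_mul_partitionSum hθ hε h
  have hpos := eventually_partitionSum_pos hΘ hθ hε h
  obtain ⟨L, hL⟩ := h
  have h0 := hL 0
  simp only [partitionSum_truncate_zero] at h0
  have hp0 : initialPoly Θ 0 r = 0 := by simp [initialPoly]
  rw [hp0, sub_zero] at h0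
  set p := initialPoly Θ b r with hp
  have hexp : Complex.exp (-p) =
      (Real.exp (-∑ m ∈ Finset.Icc 1 b, Θ m / m * r ^ m) : ℝ) := by
    rw [hp, initialPoly]; push_cast; rfl
  have hshift : Tendsto (fun n : ℕ => n - s) atTop atTop := tendsto_sub_atTop_nat s
  have h1 : (fun n : ℕ => (r : ℂ) ^ (n - s) * (partitionSum (truncate b Θ) (n - s) : ℂ) -
      negBinomCoeff θ (n - s) * Complex.exp (L - p)) =O[atTop]
        fun n : ℕ => (n : ℝ) ^ (θ - 1) * ε n :=
    ((hL b).comp_tendsto hshift).trans ((isBigO_shift_rpow s (θ - 1)).mul (hε.shift_isBigO s))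
  have h2 : (fun n : ℕ => ((negBinomCoeff θ (n - s) - negBinomCoeff θ n : ℝ) : ℂ) *
      Complex.exp (L - p)) =O[atTop] fun n : ℕ => (n : ℝ) ^ (θ - 1) * ε n := by
    obtain ⟨D, hD0, hD⟩ := abs_negBinomCoeff_sub_le hθ
    have h3 : (fun n : ℕ => ((negBinomCoeff θ (n - s) - negBinomCoeff θ n : ℝ) : ℂ)) =O[atTop]
        fun n : ℕ => ((n : ℝ) + 1) ^ (θ - 2) := by
      refine IsBigO.of_bound (D * s) ?_
      filter_upwards [eventually_ge_atTop (2 * s)] with n hn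
      rw [Complex.norm_real, Real.norm_eq_abs, Real.norm_of_nonneg (by positivity)]
      exact hD n s hn
    have h4 : (fun n : ℕ => (n : ℝ) ^ (θ - 2)) =O[atTop] fun n : ℕ => (n : ℝ) ^ (θ - 1) * ε n := by
      refine (((isBigO_refl (fun n : ℕ => (n : ℝ) ^ (θ - 1)) atTop).mul
        hε.one_div_isBigO)).congr' ?_ EventuallyEq.rfl
      filter_upwards [eventually_gt_atTop 0] with n hn
      have hn' : (n : ℝ) ≠ 0 := by exact_mod_cast hn.ne'
      rw [mul_one_div, ← Real.rpow_sub_one hn']; congr 1; ring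
    have h5 := (h3.trans (isBigO_add_one_rpow _)).trans h4
    simpa [mul_comm] using h5.const_mul_left (Complex.exp (L - p))
  -- Multiplying the expansion for b = 0 by exp(-p) gives the same main term a_n exp(L - p), which
  -- cancels.
  have h6 := (h1.add h2).sub (h0.const_mul_left (Complex.exp (-p)))
  have h7 : (fun n : ℕ => (r : ℂ) ^ (n - s) * (partitionSum (truncate b Θ) (n - s) : ℂ) -
      Complex.exp (-p) * ((r : ℂ) ^ n * (partitionSum Θ n : ℂ))) =O[atTop]
        fun n : ℕ => (n : ℝ) ^ (θ - 1) * ε n := by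
    refine h6.congr_left fun n => ?_
    rw [sub_eq_add_neg L p, Complex.exp_add]
    push_cast
    ring
  obtain ⟨C₁, hC₁, hb₁⟩ := h7.exists_pos
  obtain ⟨C₂, hC₂, hb₂⟩ := hu.exists_pos
  refine IsBigO.of_bound (r ^ s * (C₁ * C₂)) ?_
  filter_upwards [hb₁.bound, hb₂.bound, hpos, eventually_ge_atTop s] with n hn₁ hn₂ hn hns
  set E := Real.exp (-∑ m ∈ Finset.Icc 1 b, Θ m / m * r ^ m) with hE
  set T := partitionSum (truncate b Θ) (n - s) with hT
  set u := r ^ n * partitionSum Θ n with hu'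
  have hupos : 0 < u := mul_pos (pow_pos hr n) hn
  have e1 : (r : ℂ) ^ (n - s) * (T : ℂ) - Complex.exp (-p) * ((r : ℂ) ^ n * (partitionSum Θ n : ℂ)) =
      ((r ^ (n - s) * T - E * u : ℝ) : ℂ) := by
    rw [hexp, hu']; push_cast; rfl
  have e2 : (r : ℂ) ^ n * (partitionSum Θ n : ℂ) = ((u : ℝ) : ℂ) := by
    rw [hu']; push_cast; rfl
  rw [e1, Complex.norm_real, norm_mul] at hn₁
  rw [e2, Complex.norm_real, Real.norm_of_nonneg hupos.le] at hn₂
  have hpow : r ^ s * r ^ (n - s) = r ^ n := by rw [← pow_add]; congr 1; omega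
  have e3 : T / partitionSum Θ n - r ^ s * E = r ^ s * ((r ^ (n - s) * T - E * u) / u) := by
    have h9 : r ^ s * (r ^ (n - s) * T) = r ^ n * T := by rw [← mul_assoc, hpow]
    rw [← mul_div_assoc, mul_sub, h9, sub_div, hu', mul_div_mul_left _ _ (pow_ne_zero n hr.ne')]
    congr 1
    have := hn.ne'
    have := hr.ne'
    field_simp
  rw [e3, norm_mul, norm_div, Real.norm_of_nonneg (pow_pos hr s).le,
    Real.norm_of_nonneg hupos.le, mul_assoc (r ^ s)]
  refine mul_le_mul_of_nonneg_left ?_ (pow_pos hr s).le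
  rw [div_le_iff₀ hupos]
  calc _ ≤ C₁ * (‖(n : ℝ) ^ (θ - 1)‖ * ‖ε n‖) := hn₁
    _ ≤ C₁ * ((C₂ * u) * ‖ε n‖) := by gcongr
    _ = _ := by ring

end Ratio

lemma isErrorRate_one_div : IsErrorRate fun n : ℕ => 1 / (n : ℝ) where
  tendsto_zero := tendsto_one_div_atTop_nhds_zero_nat
  one_div_isBigO := isBigO_refl _ _
  shift_isBigO s := by
    refine (isBigO_shift_rpow s (-1)).congr (fun n => ?_) fun n => ?_ <;>
      rw [Real.rpow_neg_one, one_div]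

lemma isErrorRate_log {γ : ℝ} (hγ : 0 < γ) (hγ1 : γ ≤ 1) :
    IsErrorRate fun n : ℕ => Real.log (n : ℝ) / (n : ℝ) ^ γ where
  tendsto_zero :=
    (isLittleO_log_rpow_atTop hγ).tendsto_div_nhds_zero.comp tendsto_natCast_atTop_atTop
  one_div_isBigO := by
    refine IsBigO.of_bound 1 ?_
    filter_upwards [eventually_ge_atTop 3] with n hn
    have hn' : (3 : ℝ) ≤ n := by exact_mod_cast hn
    have h2 : 1 ≤ Real.log n := by
      rw [Real.le_log_iff_exp_le (by linarith)]
      linarith [Real.exp_one_lt_d9]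
    have h3 : (n : ℝ) ^ γ ≤ n := by
      simpa using Real.rpow_le_rpow_of_exponent_le (by linarith : (1 : ℝ) ≤ n) hγ1
    rw [Real.norm_of_nonneg (by positivity), Real.norm_of_nonneg (by positivity), one_mul]
    exact div_le_div₀ (by linarith) h2 (by positivity) h3
  shift_isBigO s := by
    have h1 : (fun n : ℕ => Real.log ((n - s : ℕ) : ℝ)) =O[atTop] fun n : ℕ => Real.log (n : ℝ) := by
      refine IsBigO.of_bound 1 (Eventually.of_forall fun n => ?_)
      rw [one_mul, Real.norm_of_nonneg (Real.log_natCast_nonneg _),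
        Real.norm_of_nonneg (Real.log_natCast_nonneg _)]
      -- For n ≤ s the truncated difference is 0 and its logarithm is 0 by convention.
      rcases Nat.eq_zero_or_pos (n - s) with h | h
      · rw [h]; simpa using Real.log_natCast_nonneg n
      · exact Real.log_le_log (by exact_mod_cast h) (by exact_mod_cast Nat.sub_le n s)
    refine (h1.mul (isBigO_shift_rpow s (-γ))).congr (fun n => ?_) fun n => ?_ <;>
      rw [Real.rpow_neg (by positivity), div_eq_mul_inv]

/-! ### Point probabilities of cycle counts and of Poisson vectors -/

lemma weight_nonneg {Θ : ℕ → ℝ} (hΘ : ∀ m : ℕ, 1 ≤ m → 0 ≤ Θ m) {n : ℕ}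
    (σ : Equiv.Perm (Fin n)) : 0 ≤ weight Θ σ :=
  Finset.prod_nonneg fun m hm => pow_nonneg (hΘ m (Finset.mem_Icc.1 hm).1) _

/-- The mass of an event which depends on the cycle type only. -/
lemma permMeasure_setOf {Θ : ℕ → ℝ} (hΘ : ∀ m : ℕ, 1 ≤ m → 0 ≤ Θ m) (n : ℕ)
    (Q : Multiset ℕ → Prop) [DecidablePred Q] :
    permMeasure Θ n {σ | Q σ.partition.parts} =
      ENNReal.ofReal ((∑ p : n.Partition, multisetWeight Θ p.parts *
        (if Q p.parts then 1 else 0)) / partitionSum Θ n) := by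
  have h0 := partitionSum_nonneg hΘ n
  rw [← normConst_eq_partitionSum] at h0
  rw [← sum_weight_mul_div_factorial Θ n fun M => if Q M then 1 else 0, div_div,
    ← normConst_eq_partitionSum, mul_comm (n.factorial : ℝ), Finset.sum_div,
    ENNReal.ofReal_sum_of_nonneg]
  · rw [permMeasure, Measure.finsetSum_apply]
    refine Finset.sum_congr rfl fun σ _ => ?_
    rw [Measure.smul_apply, Measure.dirac_apply' _ (MeasurableSet.of_discrete), smul_eq_mul]
    by_cases h : Q σ.partition.parts
    · rw [if_pos h, Set.indicator_of_mem (by exact h)]; simp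
    · rw [if_neg h, Set.indicator_of_notMem (by exact h)]; simp
  · intro σ _
    have := weight_nonneg hΘ σ
    split_ifs <;> positivity

lemma isProbabilityMeasure_permMeasure {Θ : ℕ → ℝ} (hΘ : ∀ m : ℕ, 1 ≤ m → 0 ≤ Θ m) {n : ℕ}
    (hn : 0 < partitionSum Θ n) : IsProbabilityMeasure (permMeasure Θ n) := by
  refine ⟨?_⟩
  have h := permMeasure_setOf hΘ n fun _ => True
  simp only [if_true, mul_one] at h
  rw [← partitionSum, div_self hn.ne', ENNReal.ofReal_one] at h
  exact h

lemma permMeasure_real_cycleVector {Θ : ℕ → ℝ} (hΘ : ∀ m : ℕ, 1 ≤ m → 0 ≤ Θ m) {b : ℕ}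
    (c : Fin b → ℕ) {n : ℕ} (hn : (multisetOfCounts c).sum ≤ n) :
    (permMeasure Θ n).real {σ | ∀ i : Fin b, cycleVector b n σ i = c i} =
      multisetWeight Θ (multisetOfCounts c) *
        (partitionSum (truncate b Θ) (n - (multisetOfCounts c).sum) / partitionSum Θ n) := by
  have h := permMeasure_setOf hΘ n fun M => ∀ i : Fin b, M.count ((i : ℕ) + 1) = c i
  rw [sum_partition_counts Θ c hn] at h
  have hset : {σ : Equiv.Perm (Fin n) | ∀ i : Fin b, cycleVector b n σ i = c i} =
      {σ | ∀ i : Fin b, σ.partition.parts.count ((i : ℕ) + 1) = c i} := rfl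
  rw [hset, measureReal_def, h, ENNReal.toReal_ofReal, mul_div_assoc]
  have h1 : 0 ≤ partitionSum (truncate b Θ) (n - (multisetOfCounts c).sum) :=
    partitionSum_nonneg (fun m hm => by
      unfold truncate; split_ifs; exacts [le_rfl, hΘ m hm]) _
  exact div_nonneg (mul_nonneg (multisetWeight_nonneg hΘ _ fun m hm =>
    (mem_multisetOfCounts hm).1) h1) (partitionSum_nonneg hΘ n)

section Poisson

variable {Θ : ℕ → ℝ} {r : ℝ} {b : ℕ} {Ω : Type*} [MeasurableSpace Ω] {P : Measure Ω}
  {Y : Fin b → Ω → ℕ}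

/-- The product of Poisson masses is arranged with the same factor as in
`permMeasure_real_cycleVector`, so that only the ratio of partition sums is left to compare. -/
lemma measureReal_poisson_vector (hΘ : ∀ m : ℕ, 1 ≤ m → 0 ≤ Θ m) (hr : 0 < r)
    (hYindep : iIndepFun Y P)
    (hYlaw : ∀ i : Fin b, HasLaw (Y i)
      (poissonMeasure
        (Real.toNNReal (Θ ((i : ℕ) + 1) / (((i : ℕ) + 1 : ℕ) : ℝ) * r ^ ((i : ℕ) + 1)))) P)
    (c : Fin b → ℕ) :
    P.real {ω | ∀ i : Fin b, Y i ω = c i} = multisetWeight Θ (multisetOfCounts c) *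
      (r ^ (multisetOfCounts c).sum *
        Real.exp (-∑ m ∈ Finset.Icc 1 b, Θ m / m * r ^ m)) := by
  have h1 := hYindep.measure_inter_preimage_eq_mul Finset.univ (sets := fun i => {c i})
    fun i _ => MeasurableSet.of_discrete
  have hset : {ω | ∀ i : Fin b, Y i ω = c i} = ⋂ i ∈ Finset.univ, Y i ⁻¹' {c i} := by
    ext ω; simp
  have hfac : ∀ i : Fin b, (P (Y i ⁻¹' {c i})).toReal =
      (Θ ((i : ℕ) + 1) / ((i : ℕ) + 1 : ℕ)) ^ c i / (c i).factorial *
        ((r ^ (c i * ((i : ℕ) + 1))) *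
          Real.exp (-(Θ ((i : ℕ) + 1) / ((i : ℕ) + 1 : ℕ) * r ^ ((i : ℕ) + 1)))) := fun i => by
    have h0 : 0 ≤ Θ ((i : ℕ) + 1) / (((i : ℕ) + 1 : ℕ) : ℝ) * r ^ ((i : ℕ) + 1) := by
      have := hΘ ((i : ℕ) + 1) (by omega)
      positivity
    rw [← Measure.map_apply_of_aemeasurable (hYlaw i).aemeasurable MeasurableSet.of_discrete,
      (hYlaw i).map_eq, ← measureReal_def, poissonMeasure_real_singleton,
      Real.coe_toNNReal _ h0, mul_pow, ← pow_mul, mul_comm ((i : ℕ) + 1) (c i)]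
    ring
  rw [hset, measureReal_def, h1, ENNReal.toReal_prod, Finset.prod_congr rfl fun i _ => hfac i,
    Finset.prod_mul_distrib, Finset.prod_mul_distrib, multisetWeight_multisetOfCounts,
    Finset.prod_pow_eq_pow_sum, sum_multisetOfCounts, ← Real.exp_sum, Finset.sum_neg_distrib]
  -- The exponents agree after shifting the index set `Fin b` to 1, …, b.
  congr 4
  rw [Finset.sum_fin_eq_sum_range, ← Finset.sum_image (s := Finset.range b) (g := fun k => k + 1)
      (f := fun m : ℕ => Θ m / m * r ^ m) (by simp) |>.symm.trans (Finset.sum_congr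
        (by ext m; simp only [Finset.mem_image, Finset.mem_range, Finset.mem_Icc]
            exact ⟨fun ⟨a, ha, hb⟩ => by omega, fun hm => ⟨m - 1, by omega, by omega⟩⟩)
        fun _ _ => rfl)]
  exact Finset.sum_congr rfl fun k hk => by rw [dif_pos (Finset.mem_range.1 hk)]

variable {θ : ℝ} {ε : ℕ → ℝ}

lemma isBigO_abs_sub_of_nat (hΘ : ∀ m : ℕ, 1 ≤ m → 0 ≤ Θ m) (hr : 0 < r) (hθ : 0 < θ)
    (hε : IsErrorRate ε) (h : HasExpAsymptotics Θ r θ ε)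
    (hYindep : iIndepFun Y P)
    (hYlaw : ∀ i : Fin b, HasLaw (Y i)
      (poissonMeasure
        (Real.toNNReal (Θ ((i : ℕ) + 1) / (((i : ℕ) + 1 : ℕ) : ℝ) * r ^ ((i : ℕ) + 1)))) P)
    (c : Fin b → ℕ) :
    (fun n : ℕ => |(permMeasure Θ n).real {σ | ∀ i : Fin b, cycleVector b n σ i = c i} -
      P.real {ω | ∀ i : Fin b, Y i ω = c i}|) =O[atTop] ε := by
  have h1 := (partitionSum_ratio_isBigO hr hΘ hθ hε h b
    (multisetOfCounts c).sum).const_mul_left (multisetWeight Θ (multisetOfCounts c))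
  refine IsBigO.abs_left (h1.congr' ?_ EventuallyEq.rfl)
  filter_upwards [eventually_ge_atTop (multisetOfCounts c).sum] with n hn
  rw [permMeasure_real_cycleVector hΘ c hn, measureReal_poisson_vector hΘ hr hYindep hYlaw,
    mul_sub]

/-- If some c_i is negative, both events are empty; otherwise c comes from natural numbers. -/
lemma isBigO_abs_sub_of_int (hΘ : ∀ m : ℕ, 1 ≤ m → 0 ≤ Θ m) (hr : 0 < r) (hθ : 0 < θ)
    (hε : IsErrorRate ε) (h : HasExpAsymptotics Θ r θ ε)
    (hYindep : iIndepFun Y P)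
    (hYlaw : ∀ i : Fin b, HasLaw (Y i)
      (poissonMeasure
        (Real.toNNReal (Θ ((i : ℕ) + 1) / (((i : ℕ) + 1 : ℕ) : ℝ) * r ^ ((i : ℕ) + 1)))) P)
    (c : Fin b → ℤ) :
    (fun n : ℕ => |(permMeasure Θ n).real {σ | ∀ i : Fin b, (cycleVector b n σ i : ℤ) = c i} -
      P.real {ω | ∀ i : Fin b, (Y i ω : ℤ) = c i}|) =O[atTop] ε := by
  by_cases hc : ∀ i, 0 ≤ c i
  · lift c to Fin b → ℕ using hc
    simpa only [Nat.cast_inj] using isBigO_abs_sub_of_nat hΘ hr hθ hε h hYindep hYlaw c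
  · push Not at hc
    obtain ⟨i, hi⟩ := hc
    have h1 (n : ℕ) :
        {σ : Equiv.Perm (Fin n) | ∀ i : Fin b, (cycleVector b n σ i : ℤ) = c i} = ∅ :=
      Set.eq_empty_of_forall_notMem fun σ hσ => by have := hσ i; omega
    have h2 : {ω | ∀ i : Fin b, (Y i ω : ℤ) = c i} = ∅ :=
      Set.eq_empty_of_forall_notMem fun ω hω => by have := hω i; omega
    simp only [h1, h2, measureReal_empty, sub_self, abs_zero]
    exact isBigO_zero _ _

end Poisson

/-! ### Weak convergence and conclusion -/

/-- On a countable discrete space, convergence of point masses implies weak convergence. -/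
lemma tendsto_probabilityMeasure_of_singleton {E : Type*} [TopologicalSpace E] [Countable E]
    [MeasurableSpace E] [MeasurableSingletonClass E] [OpensMeasurableSpace E]
    {μ : ProbabilityMeasure E} {μs : ℕ → ProbabilityMeasure E}
    (h : ∀ x, Tendsto (fun n => (μs n : Measure E) {x}) atTop (𝓝 ((μ : Measure E) {x}))) :
    Tendsto μs atTop (𝓝 μ) := by
  -- By the portmanteau theorem it suffices to bound the mass of open sets from below. Such a mass
  -- is an integral of point masses against counting measure, so Fatou's lemma applies.
  refine tendsto_of_forall_isOpen_le_liminf_nat' fun G _ => ?_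
  have hG (ν : Measure E) : ν G = ∫⁻ x, G.indicator (fun x => ν {x}) x ∂Measure.count := by
    rw [lintegral_count, ← tsum_subtype]
    have := measure_biUnion (μ := ν) (s := G) (f := fun x => {x}) (Set.to_countable G)
      (fun x _ y _ hxy => by simpa using hxy) (fun x _ => measurableSet_singleton x)
    rwa [Set.biUnion_of_singleton] at this
  rw [hG]
  simp_rw [hG (μs _ : Measure E)]
  refine le_trans (le_of_eq ?_) (lintegral_liminf_le fun n => measurable_of_countable _)
  refine lintegral_congr fun x => ?_
  by_cases hx : x ∈ G
  · simp only [Set.indicator_of_mem hx]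
    exact (h x).liminf_eq.symm
  · simp [Set.indicator_of_notMem hx]

/-- The shift by N discards the small n with h_n = 0, since every measure in the sequence must be a
probability measure. Convergence of point masses then suffices on the countable space `Fin b → ℕ`.
-/
theorem exists_tendstoInDistribution {Θ : ℕ → ℝ} {r θ : ℝ} {b : ℕ} {Ω : Type*}
    [MeasurableSpace Ω] {P : Measure Ω} [IsProbabilityMeasure P] {Y : Fin b → Ω → ℕ} {ε : ℕ → ℝ}
    (hΘ : ∀ m : ℕ, 1 ≤ m → 0 ≤ Θ m) (hr : 0 < r) (hθ : 0 < θ)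
    (hε : IsErrorRate ε) (h : HasExpAsymptotics Θ r θ ε)
    (hYindep : iIndepFun Y P)
    (hYlaw : ∀ i : Fin b, HasLaw (Y i)
      (poissonMeasure
        (Real.toNNReal (Θ ((i : ℕ) + 1) / (((i : ℕ) + 1 : ℕ) : ℝ) * r ^ ((i : ℕ) + 1)))) P) :
    ∃ (N : ℕ) (_ : ∀ n : ℕ, IsProbabilityMeasure (permMeasure Θ (n + N))),
      TendstoInDistribution (fun n : ℕ => cycleVector b (n + N)) atTop
        (fun (ω : Ω) (i : Fin b) => Y i ω)
        (fun n : ℕ => permMeasure Θ (n + N)) P := by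
  obtain ⟨N, hN⟩ := eventually_atTop.1 (eventually_partitionSum_pos hΘ hθ hε h)
  have hprob (n : ℕ) : IsProbabilityMeasure (permMeasure Θ (n + N)) :=
    isProbabilityMeasure_permMeasure hΘ (hN _ (by omega))
  have hYm : AEMeasurable (fun (ω : Ω) (i : Fin b) => Y i ω) P :=
    aemeasurable_pi_lambda _ fun i => (hYlaw i).aemeasurable
  have hXm (n : ℕ) : AEMeasurable (cycleVector b (n + N)) (permMeasure Θ (n + N)) :=
    Measurable.of_discrete.aemeasurable
  refine ⟨N, hprob, hXm, hYm, tendsto_probabilityMeasure_of_singleton fun c => ?_⟩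
  simp only [ProbabilityMeasure.coe_mk]
  rw [Measure.map_apply_of_aemeasurable hYm (measurableSet_singleton c)]
  simp_rw [Measure.map_apply_of_aemeasurable (hXm _) (measurableSet_singleton c)]
  rw [← ENNReal.tendsto_toReal_iff (fun n => measure_ne_top _ _) (measure_ne_top _ _)]
  have h1 := (isBigO_abs_sub_of_nat hΘ hr hθ hε h hYindep hYlaw c).trans_tendsto hε.tendsto_zero
  rw [tendsto_zero_iff_abs_tendsto_zero] at h1
  have h2 := tendsto_sub_nhds_zero_iff.1
    ((tendsto_zero_iff_abs_tendsto_zero _).2 (by simpa [Function.comp_def] using h1))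
  have h3 := h2.comp (tendsto_add_atTop_nat N)
  have hs1 (n : ℕ) : cycleVector b (n + N) ⁻¹' {c} =
      {σ | ∀ i : Fin b, cycleVector b (n + N) σ i = c i} := by
    ext σ; simp [funext_iff]
  have hs2 : (fun (ω : Ω) (i : Fin b) => Y i ω) ⁻¹' {c} = {ω | ∀ i : Fin b, Y i ω = c i} := by
    ext ω; simp [funext_iff]
  simp only [hs1, hs2]
  exact h3

end WeightedPerm
end

theorem mainTheorem2
    (Θ : ℕ → ℝ) (hΘ : ∀ m : ℕ, 1 ≤ m → 0 ≤ Θ m)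
    (r θ γ : ℝ) (hr : 0 < r) (hθ : 0 < θ) (hγ : 0 < γ) (hγ1 : γ ≤ 1)
    (b : ℕ)
    {Ω : Type*} [MeasurableSpace Ω] (P : Measure Ω) [IsProbabilityMeasure P]
    (Y : Fin b → Ω → ℕ) (hYindep : iIndepFun Y P)
    (hYlaw : ∀ i : Fin b, HasLaw (Y i)
      (poissonMeasure
        (Real.toNNReal (Θ ((i : ℕ) + 1) / (((i : ℕ) + 1 : ℕ) : ℝ) * r ^ ((i : ℕ) + 1)))) P) :
    ((WeightedPerm.SeriesClassF r θ (WeightedPerm.gSeries Θ) ∨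
        WeightedPerm.SeriesClassEF r θ γ (WeightedPerm.gSeries Θ)) →
      ∃ (N : ℕ) (_ : ∀ n : ℕ, IsProbabilityMeasure (WeightedPerm.permMeasure Θ (n + N))),
        TendstoInDistribution (fun n : ℕ => WeightedPerm.cycleVector b (n + N)) atTop
          (fun (ω : Ω) (i : Fin b) => Y i ω)
          (fun n : ℕ => WeightedPerm.permMeasure Θ (n + N)) P) ∧
    (WeightedPerm.SeriesClassF r θ (WeightedPerm.gSeries Θ) →
      ∀ c : Fin b → ℤ,
        (fun n : ℕ =>
          |(WeightedPerm.permMeasure Θ n).real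
              {σ | ∀ i : Fin b, (WeightedPerm.cycleVector b n σ i : ℤ) = c i} -
            P.real {ω | ∀ i : Fin b, (Y i ω : ℤ) = c i}|)
          =O[atTop] fun n : ℕ => 1 / (n : ℝ)) ∧
    (WeightedPerm.SeriesClassEF r θ γ (WeightedPerm.gSeries Θ) →
      ∀ c : Fin b → ℤ,
        (fun n : ℕ =>
          |(WeightedPerm.permMeasure Θ n).real
              {σ | ∀ i : Fin b, (WeightedPerm.cycleVector b n σ i : ℤ) = c i} -
            P.real {ω | ∀ i : Fin b, (Y i ω : ℤ) = c i}|)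
          =O[atTop] fun n : ℕ => Real.log (n : ℝ) / (n : ℝ) ^ γ) := by
  have hF : WeightedPerm.SeriesClassF r θ (WeightedPerm.gSeries Θ) →
      WeightedPerm.HasExpAsymptotics Θ r θ fun n : ℕ => 1 / (n : ℝ) :=
    WeightedPerm.SeriesClassF.exists_isBigO hr hθ
  have hEF : WeightedPerm.SeriesClassEF r θ γ (WeightedPerm.gSeries Θ) →
      WeightedPerm.HasExpAsymptotics Θ r θ fun n : ℕ => Real.log (n : ℝ) / (n : ℝ) ^ γ :=
    WeightedPerm.SeriesClassEF.exists_isBigO hr hθ hγ hγ1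
  refine ⟨?_, fun h c => ?_, fun h c => ?_⟩
  · rintro (h | h)
    · exact WeightedPerm.exists_tendstoInDistribution hΘ hr hθ
        WeightedPerm.isErrorRate_one_div (hF h) hYindep hYlaw
    · exact WeightedPerm.exists_tendstoInDistribution hΘ hr hθ
        (WeightedPerm.isErrorRate_log hγ hγ1) (hEF h) hYindep hYlaw
  · exact WeightedPerm.isBigO_abs_sub_of_int hΘ hr hθ WeightedPerm.isErrorRate_one_div (hF h)
      hYindep hYlaw c
  · exact WeightedPerm.isBigO_abs_sub_of_int hΘ hr hθ (WeightedPerm.isErrorRate_log hγ hγ1)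
      (hEF h) hYindep hYlaw c
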